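/- Let $M,m,g,l_0>0$ and consider the crane dynamics $\dot X=f(X)+g(X)F$ with state $X=(x,\dot x,\theta,\dot\theta,l,\dot l)^T$, input $F=(f_1,f_2)^T$ and $$f(X)=\begin{bmatrix}\dot x\\0\\\dot\theta\\-\frac2l\dot l\dot\theta-\frac gl\sin\theta\\\dot l\\ l\dot\theta^2+g\cos\theta\end{bmatrix},\qquad g(X)=\begin{bmatrix}0&0\\\frac1M&-\frac{\sin\theta}M\\0&0\\-\frac{\cos\theta}{Ml}&\frac{\sin\theta\cos\theta}{Ml}\\0&0\\-\frac{\sin\theta}M&\frac{\sin^2\theta}M+\frac1m\end{bmatrix}.$$ Let $K=\begin{bmatrix}k_1&k_2&k_3&k_4&0&0\\0&0&0&0&k_5&k_6\end{bmatrix}$ satisfy $$k_1>0,\quad k_2l_0-k_4>0,\quad \frac{-k_4Mg}{k_2l_0-k_4}+k_1l_0-k_3+mg>0,\quad \frac{-k_2k_4Mg+(k_2l_0-k_4)(k_1k_4-k_2k_3+k_2mg)}{-k_4Mg+(k_2l_0-k_4)(k_1l_0-k_3+mg)}>0,\quad k_5>0,\quad k_6>0.$$ For a $C^4$ desired output trajectory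 $Y_d=(y_{1,d},y_{2,d})$, $t\ge 0$, with $y_{2,d}<0$ and $\ddot y_{2,d}>-g$ (the outputs being the payload position $y_1=x+l\sin\theta$, $y_2=-l\cos\theta$), let the desired state be $X_d=(x_d,\dot x_d,\theta_d,\dot\theta_d,l_d,\dot l_d)^T$, where $$x_d=y_{1,d}-\frac{\ddot y_{1,d}\,y_{2,d}}{\ddot y_{2,d}+g},\qquad l_d=\Bigl(\Bigl(\frac{\ddot y_{1,d}\,y_{2,d}}{\ddot y_{2,d}+g}\Bigr)^2+y_{2,d}^2\Bigr)^{1/2},\qquad \theta_d=\arctan\frac{-\ddot y_{1,d}}{\ddot y_{2,d}+g},$$ and $\dot x_d,\dot\theta_d,\dot l_d$ are their time derivatives. Write $s_d=\sin\theta_d$, $c_d=\cos\theta_d$. The feedforward input $F_{ff}=(f_{1,ff},f_{2,ff})^T$ is given by $$f_{1,ff}=\frac{Ml_d}{f_{2,ff}c_d}\Bigl(-m\bigl(c_dy_{1,d}^{(4)}+s_dy_{2,d}^{(4)}\bigr)+2\dot f_{2,ff}\dot\theta_d+\frac{f_{2,ff}^2s_dc_d}{Ml_d}-\frac2{l_d}f_{2,ff}\dot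 l_d\dot\theta_d-\frac g{l_d}f_{2,ff}s_d\Bigr),$$ $$\ddot f_{2,ff}=m\bigl(s_dy_{1,d}^{(4)}-c_dy_{2,d}^{(4)}\bigr)+f_{2,ff}\dot\theta_d^2,$$ with the initial values consistent with $Y_d$, namely $f_{2,ff}(0)=m\bigl(s_d\ddot y_{1,d}-c_d(\ddot y_{2,d}+g)\bigr)\big|_{t=0}$ and $\dot f_{2,ff}(0)=m\bigl(s_dy^{(3)}_{1,d}-c_dy^{(3)}_{2,d}\bigr)\big|_{t=0}$ (so $-mg$ and $0$ when starting from rest). Then there are $\varepsilon,\delta>0$, depending only on $M,m,g,l_0,K$, such that for every such $Y_d$ with $\|Y_d^{(i)}(t)\|\le\varepsilon$ for all $t\ge0$ and $i=1,\dots,4$, and with $|l_d(t)-l_0|\le\delta$ for all $t\ge0$, the origin is an exponentially stable equilibrium of the dynamics $\dot E=f(X)+g(X)F-\dot X_d$ of the tracking error $E=X-X_d$ under the input $F=F_{ff}+F_{fb}$, $F_{fb}=-KE$. That is, there are $c,k,r>0$ such that for all $t_0\ge0$ and all initial errors with $\|E(t_0)\|<c$, a solution exists on $[t_0,\infty)$,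 and every solution with this initial value satisfies $\|E(t)\|\le k\|E(t_0)\|e^{-r(t-t_0)}$ for all $t\ge t_0$ for which it is defined. -/

import Mathlib

noncomputable section

namespace Crane

/-- State space: `X = (x, x', θ, θ', l, l')`, with the Euclidean norm. -/
abbrev State := EuclideanSpace ℝ (Fin 6)

/-- Output space: `Y = (y₁, y₂)`, with the Euclidean norm. -/
abbrev Output := EuclideanSpace ℝ (Fin 2)

/-- The drift `f(X)` of the crane dynamics `X' = f(X) + g(X) F`. -/
def drift (grav : ℝ) (X : State) : State :=
  !₂[X 1,
     0,
     X 3,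
     -(2 / X 4) * X 5 * X 3 - grav / X 4 * Real.sin (X 2),
     X 5,
     X 4 * X 3 ^ 2 + grav * Real.cos (X 2)]

/-- The input matrix `g(X)` of the crane dynamics `X' = f(X) + g(X) F`;
`M` is the mass of the cart and `m` the mass of the payload. -/
def inputMatrix (M m : ℝ) (X : State) : Matrix (Fin 6) (Fin 2) ℝ :=
  !![0, 0;
     1 / M, -Real.sin (X 2) / M;
     0, 0;
     -Real.cos (X 2) / (M * X 4), Real.sin (X 2) * Real.cos (X 2) / (M * X 4);
     0, 0;
     -Real.sin (X 2) / M, Real.sin (X 2) ^ 2 / M + 1 / m]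

/-- The right-hand side `f(X) + g(X) F` of the crane dynamics. -/
def field (M m grav : ℝ) (X : State) (F : Fin 2 → ℝ) : State :=
  drift grav X + WithLp.toLp 2 ((inputMatrix M m X).mulVec F)

/-- The gain matrix `K`. -/
def gainMatrix (k₁ k₂ k₃ k₄ k₅ k₆ : ℝ) : Matrix (Fin 2) (Fin 6) ℝ :=
  !![k₁, k₂, k₃, k₄, 0, 0;
     0, 0, 0, 0, k₅, k₆]

/-- The conditions under which the feedback `-K X` stabilizes the equilibrium
of payload length `l₀`. -/
def StabilizingGains (M m grav l₀ k₁ k₂ k₃ k₄ k₅ k₆ : ℝ) : Prop :=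
  0 < k₁ ∧
  0 < k₂ * l₀ - k₄ ∧
  0 < -k₄ * M * grav / (k₂ * l₀ - k₄) + k₁ * l₀ - k₃ + m * grav ∧
  0 < (-k₂ * k₄ * M * grav + (k₂ * l₀ - k₄) * (k₁ * k₄ - k₂ * k₃ + k₂ * m * grav)) /
      (-k₄ * M * grav + (k₂ * l₀ - k₄) * (k₁ * l₀ - k₃ + m * grav)) ∧
  0 < k₅ ∧
  0 < k₆

/-! ### The desired state, as a function of the desired output `Y` -/

/-- `Y^(i)_j`, the `i`-th time derivative of the `j`-th component of the output
(`j = 0, 1` for `y₁, y₂`). -/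
def yd (Y : ℝ → Output) (i : ℕ) (j : Fin 2) (t : ℝ) : ℝ :=
  iteratedDeriv i Y t j

/-- Desired cart position. -/
def xd (grav : ℝ) (Y : ℝ → Output) (t : ℝ) : ℝ :=
  yd Y 0 0 t - yd Y 2 0 t * yd Y 0 1 t / (yd Y 2 1 t + grav)

/-- Desired payload length. -/
def ld (grav : ℝ) (Y : ℝ → Output) (t : ℝ) : ℝ :=
  Real.sqrt ((yd Y 2 0 t * yd Y 0 1 t / (yd Y 2 1 t + grav)) ^ 2 + yd Y 0 1 t ^ 2)

/-- Desired swing angle. -/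
def thetad (grav : ℝ) (Y : ℝ → Output) (t : ℝ) : ℝ :=
  Real.arctan (-yd Y 2 0 t / (yd Y 2 1 t + grav))

/-- Desired state `X_d = (x_d, x_d', θ_d, θ_d', l_d, l_d')`. -/
def Xd (grav : ℝ) (Y : ℝ → Output) (t : ℝ) : State :=
  !₂[xd grav Y t, deriv (xd grav Y) t,
     thetad grav Y t, deriv (thetad grav Y) t,
     ld grav Y t, deriv (ld grav Y) t]

/-! ### The feedforward input -/

/-- `f₂` (with time derivative `f₂'`) is the payload force of the feedforward input for `Y`
on `[0, ∞)`: it is obtained by integrating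
`f₂'' = m (sin θ_d · y₁⁗ - cos θ_d · y₂⁗) + f₂ (θ_d')²` twice, from the initial values for which
`Y''` and `Y'''` at time `0` agree with the crane dynamics, i.e. the solution of
`y₁'' = f₂ sin θ_d / m`, `y₂'' = -g - f₂ cos θ_d / m` and of the time derivative of these
equations. Starting from rest, the initial values are `f₂ = -m g` and `f₂' = 0`. -/
structure IsFeedforwardF2 (m grav : ℝ) (Y : ℝ → Output) (f₂ f₂' : ℝ → ℝ) : Prop where
  hasDeriv : ∀ t, 0 ≤ t → HasDerivWithinAt f₂ (f₂' t) (Set.Ici 0) t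
  hasDeriv' : ∀ t, 0 ≤ t → HasDerivWithinAt f₂'
    (m * (Real.sin (thetad grav Y t) * yd Y 4 0 t - Real.cos (thetad grav Y t) * yd Y 4 1 t)
      + f₂ t * deriv (thetad grav Y) t ^ 2) (Set.Ici 0) t
  init : f₂ 0 = m * (Real.sin (thetad grav Y 0) * yd Y 2 0 0
    - Real.cos (thetad grav Y 0) * (yd Y 2 1 0 + grav))
  init' : f₂' 0 = m * (Real.sin (thetad grav Y 0) * yd Y 3 0 0
    - Real.cos (thetad grav Y 0) * yd Y 3 1 0)

/-- The cart force of the feedforward input. -/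
def feedforwardF1 (M m grav : ℝ) (Y : ℝ → Output) (f₂ f₂' : ℝ → ℝ) (t : ℝ) : ℝ :=
  let s := Real.sin (thetad grav Y t)
  let c := Real.cos (thetad grav Y t)
  let l := ld grav Y t
  let l' := deriv (ld grav Y) t
  let θ' := deriv (thetad grav Y) t
  M * l / (f₂ t * c) *
    (-m * (c * yd Y 4 0 t + s * yd Y 4 1 t) + 2 * f₂' t * θ'
      + 1 / (M * l) * f₂ t ^ 2 * s * c - 2 / l * f₂ t * l' * θ' - grav / l * f₂ t * s)

/-- The feedforward input `F_ff = (f₁, f₂)`. -/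
def feedforward (M m grav : ℝ) (Y : ℝ → Output) (f₂ f₂' : ℝ → ℝ) (t : ℝ) : Fin 2 → ℝ :=
  ![feedforwardF1 M m grav Y f₂ f₂' t, f₂ t]

/-! ### Error dynamics and stability -/

/-- Right-hand side of the dynamics `E' = X' - X_d' = f(X) + g(X) F - X_d'` of the tracking error
`E = X - X_d` under the input `F = F_ff - K E`. -/
def errorField (M m grav : ℝ) (K : Matrix (Fin 2) (Fin 6) ℝ) (Xd : ℝ → State)
    (Fff : ℝ → Fin 2 → ℝ) (t : ℝ) (E : State) : State :=
  field M m grav (Xd t + E) (Fff t + -(K.mulVec E.ofLp)) - deriv Xd t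

/-- The origin is an exponentially stable equilibrium of `e' = φ(t, e)`, `t ≥ 0`: there are
constants `c, k, r > 0` such that from every initial time `t₀ ≥ 0` and every initial value of norm
less than `c` there is a solution on `[t₀, ∞)`, and every solution with such initial data, on
whatever interval `[t₀, T)` it lives, satisfies `‖e(t)‖ ≤ k ‖e(t₀)‖ exp (-r (t - t₀))`. -/
def IsExponentiallyStableOrigin {V : Type*} [NormedAddCommGroup V] [NormedSpace ℝ V]
    (φ : ℝ → V → V) : Prop :=
  ∃ c > 0, ∃ k > 0, ∃ r > 0, ∀ t₀ : ℝ, 0 ≤ t₀ → ∀ e₀ : V, ‖e₀‖ < c →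
    (∃ e : ℝ → V, e t₀ = e₀ ∧ IsIntegralCurveOn e φ (Set.Ici t₀)) ∧
    ∀ (e : ℝ → V) (T : ℝ), e t₀ = e₀ → IsIntegralCurveOn e φ (Set.Ico t₀ T) →
      ∀ t ∈ Set.Ico t₀ T, ‖e t‖ ≤ k * ‖e₀‖ * Real.exp (-r * (t - t₀))

end Crane

end

noncomputable section

namespace Crane

open Set Filter Topology
open scoped NNReal

/-! The payload position is a flat output: payload acceleration plus gravity must point along the
cable, so the output determines the swing angle, the length and the cart position. Differentiating
these relations shows that $X_d$ solves the crane dynamics under $F_{ff}$ (`deriv_Xd_eq_field`). The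
twice-integrated payload force causes no drift: by a Grönwall argument it equals the force computed
from $Y_d''$ (`IsFeedforwardF2.eq`).

Hence the error dynamics vanish at the origin. The field does not involve the cart position, and it
involves the cart velocity only additively, so the error field depends on $t$ only through the
remaining desired states and the input. These are continuous functions of the output derivatives and
$l_d$ (`jetState`, `jetInput`), hence uniformly close to rest when the derivatives and $l_d-l_0$ are
small. By strict differentiability at rest, the error field is then, uniformly in time, a small
Lipschitz perturbation of one constant linear system (`exists_field_sub_le`).

That system splits into a quartic cart-and-swing block and a quadratic length block. The gain
conditions are the Routh–Hurwitz conditions for the quartic. They survive a small shift of the roots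
to the right, and Schwarz coordinates for the shifted polynomials give an explicit quadratic
Lyapunov function with a decay rate (`exists_lyapunov_closedLoop`). Half of this rate survives the
perturbation, and `isExponentiallyStableOrigin_of_dissipative` turns the dissipation into existence
and decay of solutions. -/

/-! ### Exponential stability from a quadratic Lyapunov function -/

section Stability

variable {V : Type*} [NormedAddCommGroup V] [NormedSpace ℝ V]

/-- The radial retraction of a normed space onto the closed ball of radius `c`. -/
def radialRetraction (c : ℝ) (e : V) : V := (c / max c ‖e‖) • e

lemma radialRetraction_of_norm_le {c : ℝ} (hc : 0 < c) {e : V} (he : ‖e‖ ≤ c) :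
    radialRetraction c e = e := by
  simp [radialRetraction, max_eq_left he, hc.ne']

lemma norm_radialRetraction_le {c : ℝ} (hc : 0 < c) (e : V) : ‖radialRetraction c e‖ ≤ c := by
  have h : 0 < max c ‖e‖ := lt_max_of_lt_left hc
  rw [radialRetraction, norm_smul, Real.norm_of_nonneg (by positivity), div_mul_eq_mul_div,
    div_le_iff₀ h]
  exact mul_le_mul_of_nonneg_left (le_max_right _ _) hc.le

lemma norm_radialRetraction_sub_le {c : ℝ} (hc : 0 < c) (e f : V) :
    ‖radialRetraction c e - radialRetraction c f‖ ≤ 2 * ‖e - f‖ := by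
  have ha : 0 < max c ‖e‖ := lt_max_of_lt_left hc
  have hb : 0 < max c ‖f‖ := lt_max_of_lt_left hc
  -- Split off the change of the scaling factor. Multiplied by `f`, it costs at most `‖e - f‖`
  -- because `‖f‖ ≤ max c ‖f‖`; together with the first term this gives the constant 2 in any normed
  -- space.
  have key : radialRetraction c e - radialRetraction c f =
      (c / max c ‖e‖) • (e - f) +
        (c / max c ‖e‖ * ((max c ‖f‖ - max c ‖e‖) / max c ‖f‖)) • f := by
    have : c / max c ‖e‖ * ((max c ‖f‖ - max c ‖e‖) / max c ‖f‖)
        = c / max c ‖e‖ - c / max c ‖f‖ := by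
      field_simp
    rw [this, radialRetraction, radialRetraction, smul_sub, sub_smul]
    abel
  have h1 : c / max c ‖e‖ ≤ 1 := (div_le_one ha).2 (le_max_left _ _)
  have h0 : 0 ≤ c / max c ‖e‖ := by positivity
  have h2 : |max c ‖f‖ - max c ‖e‖| ≤ ‖e - f‖ := by
    have := abs_max_sub_max_le_max c ‖f‖ c ‖e‖
    rw [sub_self, abs_zero, max_eq_right (abs_nonneg (‖f‖ - ‖e‖))] at this
    exact this.trans ((abs_norm_sub_norm_le f e).trans_eq (norm_sub_rev _ _))
  have h3 : ‖(c / max c ‖e‖ * ((max c ‖f‖ - max c ‖e‖) / max c ‖f‖)) • f‖ ≤ ‖e - f‖ := by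
    rw [norm_smul, norm_mul, Real.norm_of_nonneg h0, norm_div, Real.norm_of_nonneg hb.le,
      Real.norm_eq_abs, mul_assoc]
    have h4 : |max c ‖f‖ - max c ‖e‖| / max c ‖f‖ * ‖f‖ ≤ ‖e - f‖ := by
      rw [div_mul_eq_mul_div, div_le_iff₀ hb]
      exact mul_le_mul h2 (le_max_right _ _) (norm_nonneg _) (norm_nonneg _)
    exact (mul_le_of_le_one_left (by positivity) h1).trans h4
  have h5 : ‖(c / max c ‖e‖) • (e - f)‖ ≤ ‖e - f‖ := by
    rw [norm_smul, Real.norm_of_nonneg h0]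
    exact mul_le_of_le_one_left (norm_nonneg _) h1
  rw [key, two_mul]
  exact (norm_add_le _ _).trans (add_le_add h5 h3)

variable {H : Type*} [NormedAddCommGroup H] [InnerProductSpace ℝ H]

/-- Decay of the quadratic form `‖L e‖²` along a solution, when it is dissipated on a ball that
contains the sublevel set of the initial value. -/
lemma norm_sq_le_of_dissipative {φ : ℝ → V → V} {L : V →L[ℝ] H} {κ c r a b : ℝ}
    (hκ : 0 < κ) (hL : ∀ e, κ * ‖e‖ ≤ ‖L e‖) (hr : 0 < r) (hc : 0 < c)
    (hdiss : ∀ t, a ≤ t → ∀ e, ‖e‖ ≤ c → inner ℝ (L e) (L (φ t e)) ≤ -r * ‖L e‖ ^ 2)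
    {e : ℝ → V} (hcont : ContinuousOn e (Icc a b))
    (hderiv : ∀ t ∈ Ico a b, HasDerivWithinAt e (φ t (e t)) (Ici t) t)
    (hinit : ‖L (e a)‖ < κ * c) :
    ∀ t ∈ Icc a b, ‖L (e t)‖ ^ 2 ≤ ‖L (e a)‖ ^ 2 * Real.exp (-r * (t - a)) := by
  intro t ht
  -- A strict `β` keeps the barrier positive even when the initial value is zero. Dissipation gives
  -- the rate `2 * r`, the barrier decays only at rate `r`, so at a contact point the derivatives
  -- compare strictly.
  have main : ∀ β, ‖L (e a)‖ ^ 2 < β → β ≤ (κ * c) ^ 2 →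
      ‖L (e t)‖ ^ 2 ≤ β * Real.exp (-r * (t - a)) := by
    intro β hβ hβ'
    have hβ0 : 0 < β := (sq_nonneg _).trans_lt hβ
    have hB : ∀ x, HasDerivAt (fun x ↦ β * Real.exp (-r * (x - a)))
        (-r * (β * Real.exp (-r * (x - a)))) x := fun x ↦ by
      exact ((((hasDerivAt_id' x).sub_const a).const_mul (-r)).exp.const_mul β).congr_deriv
        (by ring)
    refine image_le_of_deriv_right_lt_deriv_boundary' (f := fun x ↦ ‖L (e x)‖ ^ 2)
      (f' := fun x ↦ 2 * inner ℝ (L (e x)) (L (φ x (e x))))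
      ((L.continuous.comp_continuousOn hcont).norm.pow 2)
      (fun x hx ↦ (L.hasFDerivAt.comp_hasDerivWithinAt x (hderiv x hx)).norm_sq)
      (B := fun x ↦ β * Real.exp (-r * (x - a))) (by simpa using hβ.le)
      (fun x _ ↦ (hB x).continuousAt.continuousWithinAt)
      (fun x _ ↦ (hB x).hasDerivWithinAt) ?_ ht
    intro x hx heq
    have hpos : 0 < β * Real.exp (-r * (x - a)) := by positivity
    -- At a contact point the value is at most `β`, which puts `e x` in the ball where dissipation
    -- is assumed; no prior confinement is needed.
    have hle : ‖L (e x)‖ ^ 2 ≤ (κ * c) ^ 2 := by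
      rw [heq]
      refine le_trans (mul_le_of_le_one_right hβ0.le (Real.exp_le_one_iff.2 ?_)) hβ'
      nlinarith [hx.1]
    have hex : ‖e x‖ ≤ c := by
      have := abs_le_of_sq_le_sq hle (by positivity)
      rw [abs_of_nonneg (norm_nonneg _)] at this
      exact le_of_mul_le_mul_left ((hL _).trans this) hκ
    have := hdiss x hx.1 _ hex
    rw [heq] at this
    nlinarith
  have hlt : ‖L (e a)‖ ^ 2 < (κ * c) ^ 2 := by gcongr
  have hE := Real.exp_pos (-r * (t - a))
  rw [← div_le_iff₀ hE]
  refine le_of_forall_gt_imp_ge_of_dense fun β hβ ↦ ?_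
  rw [div_le_iff₀ hE]
  refine (main _ (lt_min hβ hlt) (min_le_right _ _)).trans ?_
  gcongr
  exact min_le_left _ _

/-- A vector field that is bounded, globally Lipschitz in space and continuous in time has
solutions on `[t₀, ∞)`. -/
lemma exists_isIntegralCurveOn_Ici [CompleteSpace V] {φ : ℝ → V → V} {t₀ : ℝ} {K C : ℝ≥0}
    (hlip : ∀ t, t₀ ≤ t → LipschitzWith K (φ t))
    (hbound : ∀ t, t₀ ≤ t → ∀ e, ‖φ t e‖ ≤ C)
    (hcont : ∀ e, ContinuousOn (fun t ↦ φ t e) (Ici t₀)) (e₀ : V) :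
    ∃ e : ℝ → V, e t₀ = e₀ ∧ IsIntegralCurveOn e φ (Ici t₀) := by
  have hex : ∀ N : ℕ, ∃ α : ℝ → V, α t₀ = e₀ ∧
      ∀ t ∈ Icc t₀ (t₀ + N), HasDerivWithinAt α (φ t (α t)) (Icc t₀ (t₀ + N)) t := by
    intro N
    have hN : t₀ ≤ t₀ + N := by simp
    -- Speed at most `C` for time `N` never leaves the ball of radius `C * N`, so one
    -- Picard–Lindelöf step covers the whole interval.
    have hp : IsPicardLindelof φ (⟨t₀, le_rfl, hN⟩ : Icc t₀ (t₀ + N)) e₀ (C * N) 0 C K :=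
      { lipschitzOnWith := fun t ht ↦ (hlip t ht.1).lipschitzOnWith
        continuousOn := fun e _ ↦ (hcont e).mono fun t ht ↦ ht.1
        norm_le := fun t ht e _ ↦ hbound t ht.1 e
        mul_max_le := by simp }
    exact hp.exists_eq_forall_mem_Icc_hasDerivWithinAt₀
  choose α hα0 hα using hex
  have hright : ∀ N : ℕ, ∀ t ∈ Ico t₀ (t₀ + N),
      HasDerivWithinAt (α N) (φ t (α N t)) (Ici t) t := fun N t ht ↦
    (hα N t ⟨ht.1, ht.2.le⟩).mono_of_mem_nhdsWithin
      (mem_of_superset (Icc_mem_nhdsGE ht.2) (Icc_subset_Icc_left ht.1))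
  have hagree : ∀ N N' : ℕ, N ≤ N' → EqOn (α N) (α N') (Icc t₀ (t₀ + N)) := by
    intro N N' hNN'
    have hN : t₀ + (N : ℝ) ≤ t₀ + N' := by gcongr
    exact ODE_solution_unique_of_mem_Icc_right (s := fun _ ↦ univ) (K := K)
      (fun t ht ↦ (hlip t ht.1).lipschitzOnWith)
      (fun t ht ↦ (hα N t ht).continuousWithinAt) (hright N) (fun _ _ ↦ mem_univ _)
      (fun t ht ↦ ((hα N' t ⟨ht.1, ht.2.trans hN⟩).continuousWithinAt).mono
        (Icc_subset_Icc_right hN))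
      (fun t ht ↦ hright N' t ⟨ht.1, ht.2.trans_le hN⟩) (fun _ _ ↦ mem_univ _)
      ((hα0 N).trans (hα0 N').symm)
  have hmem : ∀ t, t₀ ≤ t → t ∈ Icc t₀ (t₀ + (⌈t - t₀⌉₊ : ℕ)) := fun t ht ↦
    ⟨ht, by linarith [Nat.le_ceil (t - t₀)]⟩
  have heq : ∀ N : ℕ, EqOn (fun t ↦ α ⌈t - t₀⌉₊ t) (α N) (Icc t₀ (t₀ + N)) := by
    intro N t ht
    rcases le_total ⌈t - t₀⌉₊ N with h | h
    · exact hagree _ _ h (hmem t ht.1)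
    · exact (hagree _ _ h ht).symm
  refine ⟨fun t ↦ α ⌈t - t₀⌉₊ t, by simpa using hα0 0, fun t ht ↦ ?_⟩
  have ht' : t₀ ≤ t := ht
  -- The extra 1 puts `t` strictly before the right endpoint, so the derivative within the interval
  -- is one within `Ici t₀`.
  set N := ⌈t - t₀⌉₊ + 1
  have htN : t < t₀ + N := by
    have := Nat.le_ceil (t - t₀)
    push_cast [N]
    linarith
  have hd : HasDerivWithinAt (fun t ↦ α ⌈t - t₀⌉₊ t) (φ t (α N t)) (Icc t₀ (t₀ + N)) t :=
    (hα N t ⟨ht', htN.le⟩).congr_of_mem (heq N) ⟨ht', htN.le⟩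
  have he : α ⌈t - t₀⌉₊ t = α N t := heq N ⟨ht', htN.le⟩
  dsimp only
  rw [he]
  refine hd.mono_of_mem_nhdsWithin ?_
  have : Iic (t₀ + (N : ℝ)) ∈ 𝓝[Ici t₀] t := mem_nhdsWithin_of_mem_nhds (Iic_mem_nhds htN)
  filter_upwards [this, self_mem_nhdsWithin] with s hs hs' using ⟨hs', hs⟩

/-- A time-varying vector field that is Lipschitz near the origin, uniformly in time, and
dissipates a positive definite quadratic form `‖L e‖²` there, has an exponentially stable
origin. -/
theorem isExponentiallyStableOrigin_of_dissipative [CompleteSpace V] {φ : ℝ → V → V}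
    {L : V →L[ℝ] H} {κ c r : ℝ} {K : ℝ≥0}
    (hκ : 0 < κ) (hL : ∀ e, κ * ‖e‖ ≤ ‖L e‖) (hr : 0 < r) (hc : 0 < c)
    (hzero : ∀ t, 0 ≤ t → φ t 0 = 0)
    (hlip : ∀ t, 0 ≤ t → ∀ e f, ‖e‖ ≤ c → ‖f‖ ≤ c → ‖φ t e - φ t f‖ ≤ K * ‖e - f‖)
    (hcont : ∀ e, ‖e‖ ≤ c → ContinuousOn (fun t ↦ φ t e) (Ici 0))
    (hdiss : ∀ t, 0 ≤ t → ∀ e, ‖e‖ ≤ c → inner ℝ (L e) (L (φ t e)) ≤ -r * ‖L e‖ ^ 2) :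
    IsExponentiallyStableOrigin φ := by
  have hLpos : 0 < ‖L‖ + 1 := by positivity
  have hLle : ∀ e, ‖L e‖ ≤ (‖L‖ + 1) * ‖e‖ := fun e ↦
    (L.le_opNorm e).trans (by gcongr; linarith)
  have hsmall : ∀ e₀ : V, ‖e₀‖ < κ * c / (‖L‖ + 1) → ‖L e₀‖ < κ * c := fun e₀ he₀ ↦ by
    rw [lt_div_iff₀ hLpos, mul_comm] at he₀
    exact (hLle e₀).trans_lt he₀
  refine ⟨κ * c / (‖L‖ + 1), by positivity, (‖L‖ + 1) / κ, by positivity, r / 2, by positivity,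
    fun t₀ ht₀ e₀ he₀ ↦ ⟨?_, ?_⟩⟩
  -- Composing with the retraction makes the field globally Lipschitz and bounded. The Lyapunov
  -- estimate then keeps its solution in the ball, where `ψ` and `φ` agree.
  · set ψ : ℝ → V → V := fun t e ↦ φ t (radialRetraction c e) with hψ
    have hψlip : ∀ t, t₀ ≤ t → LipschitzWith (K * 2) (ψ t) := fun t ht ↦
      LipschitzWith.of_dist_le_mul fun e f ↦ by
        rw [dist_eq_norm, dist_eq_norm]
        refine (hlip t (ht₀.trans ht) _ _ (norm_radialRetraction_le hc e)
          (norm_radialRetraction_le hc f)).trans ?_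
        push_cast
        rw [mul_assoc]
        gcongr
        exact norm_radialRetraction_sub_le hc e f
    have hψbound : ∀ t, t₀ ≤ t → ∀ e, ‖ψ t e‖ ≤ (K * c.toNNReal : ℝ≥0) := fun t ht e ↦ by
      have h := hlip t (ht₀.trans ht) _ 0 (norm_radialRetraction_le hc e) (by simpa using hc.le)
      rw [hzero t (ht₀.trans ht), sub_zero, sub_zero] at h
      refine h.trans ?_
      rw [NNReal.coe_mul, Real.coe_toNNReal c hc.le]
      exact mul_le_mul_of_nonneg_left (norm_radialRetraction_le hc e) K.coe_nonneg
    obtain ⟨e, he0, he⟩ := exists_isIntegralCurveOn_Ici hψlip hψbound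
      (fun e ↦ (hcont _ (norm_radialRetraction_le hc e)).mono (Ici_subset_Ici.2 ht₀)) e₀
    have hball : ∀ t, t₀ ≤ t → ‖e t‖ ≤ c := by
      intro t ht
      have h := norm_sq_le_of_dissipative (φ := ψ) (b := t) hκ hL hr hc
        (fun s hs f hf ↦ by
          simpa only [hψ, radialRetraction_of_norm_le hc hf] using hdiss s (ht₀.trans hs) f hf)
        (he.continuousOn.mono fun s hs ↦ hs.1)
        (fun s hs ↦ (he s hs.1).mono (Ici_subset_Ici.2 hs.1))
        (by rw [he0]; exact hsmall e₀ he₀) t ⟨ht, le_rfl⟩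
      rw [he0] at h
      have h1 : ‖L (e t)‖ ^ 2 ≤ ‖L e₀‖ ^ 2 :=
        h.trans (mul_le_of_le_one_right (sq_nonneg _) (Real.exp_le_one_iff.2 (by nlinarith)))
      have h2 := (abs_le_of_sq_le_sq h1 (norm_nonneg _))
      rw [abs_of_nonneg (norm_nonneg _)] at h2
      exact le_of_mul_le_mul_left (((hL _).trans h2).trans (hsmall e₀ he₀).le) hκ
    refine ⟨e, he0, fun t ht ↦ ?_⟩
    have h := he t ht
    simpa only [hψ, radialRetraction_of_norm_le hc (hball t ht)] using h
  · intro e T he0 he t ht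
    have hsub : Icc t₀ t ⊆ Ico t₀ T := fun s hs ↦ ⟨hs.1, hs.2.trans_lt ht.2⟩
    have h := norm_sq_le_of_dissipative (φ := φ) (b := t) hκ hL hr hc
      (fun s hs f hf ↦ hdiss s (ht₀.trans hs) f hf)
      (he.continuousOn.mono hsub)
      (fun s hs ↦ (he s (hsub ⟨hs.1, hs.2.le⟩)).mono_of_mem_nhdsWithin
        (mem_of_superset (Ico_mem_nhdsGE (hs.2.trans ht.2)) (Ico_subset_Ico_left hs.1)))
      (by rw [he0]; exact hsmall e₀ he₀) t ⟨ht.1, le_rfl⟩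
    rw [he0] at h
    have hexp : Real.exp (-r * (t - t₀)) = Real.exp (-(r / 2) * (t - t₀)) ^ 2 := by
      rw [← Real.exp_nat_mul]; congr 1; push_cast; ring
    rw [hexp, ← mul_pow] at h
    have h2 := abs_le_of_sq_le_sq h (by positivity)
    rw [abs_of_nonneg (norm_nonneg _)] at h2
    rw [div_mul_eq_mul_div, div_mul_eq_mul_div, le_div_iff₀ hκ, mul_comm]
    exact ((hL _).trans h2).trans (by gcongr; exact hLle e₀)

end Stability

/-! ### The closed-loop linearization is Hurwitz -/

section Linearization

/-- The Routh–Hurwitz conditions for `s⁴ + p₃ s³ + p₂ s² + p₁ s + p₀`. -/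
def RouthHurwitzQuartic (p₃ p₂ p₁ p₀ : ℝ) : Prop :=
  0 < p₃ ∧ 0 < p₃ * p₂ - p₁ ∧ 0 < p₁ * (p₃ * p₂ - p₁) - p₃ ^ 2 * p₀ ∧ 0 < p₀

/-- The Routh–Hurwitz conditions for `p(s)` persist for `p(s - σ)` if `σ` is small; the same holds
for the positivity of the coefficients of a quadratic polynomial. -/
lemma exists_pos_routhHurwitz_shift {p₃ p₂ p₁ p₀ d₁ d₀ : ℝ} (hp : RouthHurwitzQuartic p₃ p₂ p₁ p₀)
    (hd₁ : 0 < d₁) (hd₀ : 0 < d₀) :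
    ∃ σ > 0, RouthHurwitzQuartic (p₃ - 4 * σ) (p₂ - 3 * p₃ * σ + 6 * σ ^ 2)
        (p₁ - 2 * p₂ * σ + 3 * p₃ * σ ^ 2 - 4 * σ ^ 3)
        (p₀ - p₁ * σ + p₂ * σ ^ 2 - p₃ * σ ^ 3 + σ ^ 4) ∧
      0 < d₁ - 2 * σ ∧ 0 < d₀ - d₁ * σ + σ ^ 2 := by
  -- Every condition is a strict inequality between polynomials in `σ` that holds at `σ = 0`.
  have key : ∀ f : ℝ → ℝ, Continuous f → 0 < f 0 → ∀ᶠ σ in 𝓝[>] (0 : ℝ), 0 < f σ :=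
    fun f hf h0 ↦ ((hf.tendsto 0).eventually_const_lt h0).filter_mono nhdsWithin_le_nhds
  obtain ⟨h1, h2, h3, h4⟩ := hp
  have e1 := key (fun σ ↦ p₃ - 4 * σ) (by fun_prop) (by simpa using h1)
  have e2 := key (fun σ ↦ (p₃ - 4 * σ) * (p₂ - 3 * p₃ * σ + 6 * σ ^ 2) -
    (p₁ - 2 * p₂ * σ + 3 * p₃ * σ ^ 2 - 4 * σ ^ 3)) (by fun_prop) (by simpa using h2)
  have e3 := key (fun σ ↦ (p₁ - 2 * p₂ * σ + 3 * p₃ * σ ^ 2 - 4 * σ ^ 3) *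
    ((p₃ - 4 * σ) * (p₂ - 3 * p₃ * σ + 6 * σ ^ 2) -
      (p₁ - 2 * p₂ * σ + 3 * p₃ * σ ^ 2 - 4 * σ ^ 3)) -
    (p₃ - 4 * σ) ^ 2 * (p₀ - p₁ * σ + p₂ * σ ^ 2 - p₃ * σ ^ 3 + σ ^ 4)) (by fun_prop)
    (by simpa using h3)
  have e4 := key (fun σ ↦ p₀ - p₁ * σ + p₂ * σ ^ 2 - p₃ * σ ^ 3 + σ ^ 4) (by fun_prop)
    (by simpa using h4)
  have e5 := key (fun σ ↦ d₁ - 2 * σ) (by fun_prop) (by simpa using hd₁)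
  have e6 := key (fun σ ↦ d₀ - d₁ * σ + σ ^ 2) (by fun_prop) (by simpa using hd₀)
  obtain ⟨σ, h⟩ := (e1.and (e2.and (e3.and (e4.and (e5.and (e6.and
    (self_mem_nhdsWithin : Ioi (0 : ℝ) ∈ 𝓝[>] 0))))))).exists
  exact ⟨σ, h.2.2.2.2.2.2, ⟨h.1, h.2.1, h.2.2.1, h.2.2.2.1⟩, h.2.2.2.2.1, h.2.2.2.2.2.1⟩

/-- Schwarz parameters of a quartic polynomial that satisfies the Routh–Hurwitz conditions. -/
lemma RouthHurwitzQuartic.exists_schwarz {q₃ q₂ q₁ q₀ : ℝ} (hq : RouthHurwitzQuartic q₃ q₂ q₁ q₀) :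
    ∃ β₁ > 0, ∃ β₂ > 0, ∃ β₃ > 0,
      q₂ = β₁ + β₂ + β₃ ∧ q₁ = q₃ * (β₁ + β₂) ∧ q₀ = β₁ * β₃ := by
  obtain ⟨h3, hb, hc, h0⟩ := hq
  have hβ₃ : 0 < q₂ - q₁ / q₃ := by
    have : q₂ - q₁ / q₃ = (q₃ * q₂ - q₁) / q₃ := by field_simp
    rw [this]; positivity
  -- Subtracting `q₁ = q₃ * (β₁ + β₂)` from the first equation forces `β₃ = q₂ - q₁ / q₃`; the last
  -- equation then gives `β₁`. Positivity of `β₂` is the third Routh–Hurwitz condition.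
  refine ⟨q₀ / (q₂ - q₁ / q₃), by positivity, q₁ / q₃ - q₀ / (q₂ - q₁ / q₃), ?_,
    q₂ - q₁ / q₃, hβ₃, by ring, by field_simp; ring,
    (div_mul_cancel₀ _ hβ₃.ne').symm⟩
  have : q₁ / q₃ - q₀ / (q₂ - q₁ / q₃) =
      (q₁ * (q₃ * q₂ - q₁) - q₃ ^ 2 * q₀) / (q₃ ^ 2 * (q₂ - q₁ / q₃)) := by
    have := hβ₃.ne'
    rw [div_sub_div _ _ h3.ne' this, div_eq_div_iff (by positivity) (by positivity)]
    field_simp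
  rw [this]
  positivity

/-- The linearization at rest with payload length `l₀` of the crane dynamics under the feedback
`-K E`. -/
def closedLoop (M m grav l₀ k₁ k₂ k₃ k₄ k₅ k₆ : ℝ) (E : State) : State :=
  !₂[E 1,
     (-(k₁ * E 0 + k₂ * E 1 + k₃ * E 2 + k₄ * E 3) + m * grav * E 2) / M,
     E 3,
     -(grav / l₀) * E 2 + (k₁ * E 0 + k₂ * E 1 + k₃ * E 2 + k₄ * E 3) / (M * l₀)
       - m * grav / (M * l₀) * E 2,
     E 5,
     -(k₅ * E 4 + k₆ * E 5) / m]

/-- The characteristic polynomial of the cart-and-swing block of the linearization satisfies the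
Routh–Hurwitz conditions. -/
lemma StabilizingGains.routhHurwitz {M m grav l₀ k₁ k₂ k₃ k₄ k₅ k₆ : ℝ} (hM : 0 < M)
    (hgrav : 0 < grav) (hl₀ : 0 < l₀) (hK : StabilizingGains M m grav l₀ k₁ k₂ k₃ k₄ k₅ k₆) :
    RouthHurwitzQuartic ((k₂ * l₀ - k₄) / (M * l₀))
      ((k₁ * l₀ - k₃ + (M + m) * grav) / (M * l₀)) (grav * k₂ / (M * l₀))
      (grav * k₁ / (M * l₀)) := by
  obtain ⟨h1, hb, hB, hC, -, -⟩ := hK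
  set b := k₂ * l₀ - k₄ with hbdef
  -- This common expression is the denominator of the fourth gain condition and, up to `(M * l₀) ^
  -- 2`, the quantity `p₃ * p₂ - p₁`.
  have hD : 0 < -k₄ * M * grav + b * (k₁ * l₀ - k₃ + m * grav) := by
    have : -k₄ * M * grav + b * (k₁ * l₀ - k₃ + m * grav) =
      b * (-k₄ * M * grav / b + k₁ * l₀ - k₃ + m * grav) := by field_simp; ring
    rw [this]; positivity
  have hN := (div_pos_iff_of_pos_right hD).1 hC
  refine ⟨by positivity, ?_, ?_, by positivity⟩
  · have : b / (M * l₀) * ((k₁ * l₀ - k₃ + (M + m) * grav) / (M * l₀)) - grav * k₂ / (M * l₀) =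
        (-k₄ * M * grav + b * (k₁ * l₀ - k₃ + m * grav)) / (M * l₀) ^ 2 := by
      field_simp
      rw [hbdef]; ring
    rw [this]; positivity
  · have : grav * k₂ / (M * l₀) * (b / (M * l₀) * ((k₁ * l₀ - k₃ + (M + m) * grav) / (M * l₀)) -
        grav * k₂ / (M * l₀)) - (b / (M * l₀)) ^ 2 * (grav * k₁ / (M * l₀)) =
        grav * (-k₂ * k₄ * M * grav + b * (k₁ * k₄ - k₂ * k₃ + k₂ * m * grav)) / (M * l₀) ^ 3 := by
      field_simp
      rw [hbdef]; ring
    rw [this]; positivity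

/-- A positive definite quadratic form `‖L E‖²` that is dissipated along the linearization. -/
lemma exists_lyapunov_closedLoop {M m grav l₀ k₁ k₂ k₃ k₄ k₅ k₆ : ℝ} (hM : 0 < M) (hm : 0 < m)
    (hgrav : 0 < grav) (hl₀ : 0 < l₀) (hK : StabilizingGains M m grav l₀ k₁ k₂ k₃ k₄ k₅ k₆) :
    ∃ L : State →ₗ[ℝ] State, LinearMap.ker L = ⊥ ∧ ∃ σ > 0, ∀ E,
      inner ℝ (L E) (L (closedLoop M m grav l₀ k₁ k₂ k₃ k₄ k₅ k₆ E)) ≤ -σ * ‖L E‖ ^ 2 := by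
  have hRH := hK.routhHurwitz hM hgrav hl₀
  obtain ⟨-, -, -, -, hk₅, hk₆⟩ := hK
  set p₃ := (k₂ * l₀ - k₄) / (M * l₀) with hp₃
  set p₂ := (k₁ * l₀ - k₃ + (M + m) * grav) / (M * l₀) with hp₂
  set p₁ := grav * k₂ / (M * l₀) with hp₁
  set p₀ := grav * k₁ / (M * l₀) with hp₀
  obtain ⟨σ, hσ, hq, hd₁, hd₀⟩ := exists_pos_routhHurwitz_shift hRH (div_pos hk₆ hm)
    (div_pos hk₅ hm)
  obtain ⟨β₁, hβ₁, β₂, hβ₂, β₃, hβ₃, hq₂, hq₁, hq₀⟩ := hq.exists_schwarz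
  set α := p₃ - 4 * σ with hα
  have hαpos : 0 < α := hq.1
  set β := k₅ / m - k₆ / m * σ + σ ^ 2 with hβ
  -- These weights make all cross terms cancel along the chain `w₂`, `w₃ - β₁ w₁`, `w₄ - β₂ w₂`,
  -- `-β₃ w₃ - α w₄`.
  set a₁ := √(β₁ * β₂ * β₃)
  set a₂ := √(β₂ * β₃)
  set a₃ := √β₃
  set b₁ := √β
  have ha₁ : a₁ ^ 2 = β₁ * β₂ * β₃ := Real.sq_sqrt (by positivity)
  have ha₂ : a₂ ^ 2 = β₂ * β₃ := Real.sq_sqrt (by positivity)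
  have ha₃ : a₃ ^ 2 = β₃ := Real.sq_sqrt (by positivity)
  have hb₁ : b₁ ^ 2 = β := Real.sq_sqrt (by positivity)
  have ha₁0 : a₁ ≠ 0 := (Real.sqrt_pos.2 (by positivity)).ne'
  have ha₂0 : a₂ ≠ 0 := (Real.sqrt_pos.2 (by positivity)).ne'
  have ha₃0 : a₃ ≠ 0 := (Real.sqrt_pos.2 (by positivity)).ne'
  have hb₁0 : b₁ ≠ 0 := (Real.sqrt_pos.2 (by positivity)).ne'
  -- `w₁` is the linearized horizontal payload position `z`, with derivatives `E 1 + l₀ * E 3`,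
  -- `-grav * E 2` and `-grav * E 3`. With `D` the time derivative, the next coordinates are `(D +
  -- σ) z`, `(D + σ)² z + β₁ z` and `(D + σ)³ z + (β₁ + β₂) (D + σ) z`.
  let w₁ : State → ℝ := fun E ↦ E 0 + l₀ * E 2
  let w₂ : State → ℝ := fun E ↦ E 1 + l₀ * E 3 + σ * (E 0 + l₀ * E 2)
  let w₃ : State → ℝ := fun E ↦ -grav * E 2 + 2 * σ * (E 1 + l₀ * E 3) +
    (σ ^ 2 + β₁) * (E 0 + l₀ * E 2)
  let w₄ : State → ℝ := fun E ↦ -grav * E 3 + 3 * σ * (-grav * E 2) +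
    3 * σ ^ 2 * (E 1 + l₀ * E 3) + σ ^ 3 * (E 0 + l₀ * E 2) + (β₁ + β₂) * w₂ E
  let w₅ : State → ℝ := fun E ↦ E 4
  let w₆ : State → ℝ := fun E ↦ E 5 + σ * E 4
  let L : State →ₗ[ℝ] State :=
    { toFun := fun E ↦ !₂[a₁ * w₁ E, a₂ * w₂ E, a₃ * w₃ E, w₄ E, b₁ * w₅ E, w₆ E]
      map_add' := fun E F ↦ by
        ext i; fin_cases i <;> simp [w₁, w₂, w₃, w₄, w₅, w₆] <;> ring
      map_smul' := fun c E ↦ by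
        ext i; fin_cases i <;> simp [w₁, w₂, w₃, w₄, w₅, w₆] <;> ring }
  have hL : ∀ E, L E = !₂[a₁ * w₁ E, a₂ * w₂ E, a₃ * w₃ E, w₄ E, b₁ * w₅ E, w₆ E] := fun _ ↦ rfl
  refine ⟨L, ?_, σ, hσ, fun E ↦ ?_⟩
  · refine LinearMap.ker_eq_bot'.2 fun E hE ↦ ?_
    rw [hL] at hE
    have h : ∀ i : Fin 6, (!₂[a₁ * w₁ E, a₂ * w₂ E, a₃ * w₃ E, w₄ E, b₁ * w₅ E, w₆ E] : State) i
      = 0 := fun i ↦ by rw [hE]; rfl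
    have h0 : w₁ E = 0 := by simpa [ha₁0] using h 0
    have h1 : w₂ E = 0 := by simpa [ha₂0] using h 1
    have h2 : w₃ E = 0 := by simpa [ha₃0] using h 2
    have h3 : w₄ E = 0 := by simpa using h 3
    have h4 : w₅ E = 0 := by simpa [hb₁0] using h 4
    have h5 : w₆ E = 0 := by simpa using h 5
    simp only [w₁] at h0
    have h1' : E 1 + l₀ * E 3 = 0 := by simpa [w₂, h0] using h1
    simp only [w₃, h0, h1'] at h2
    have e2 : E 2 = 0 := by simpa [hgrav.ne'] using h2
    have e0 : E 0 = 0 := by simpa [e2] using h0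
    have e3 : E 3 = 0 := by simpa [w₄, h1, h1', e2, e0, hgrav.ne'] using h3
    have e1 : E 1 = 0 := by simpa [e3] using h1'
    have e4 : E 4 = 0 := h4
    have e5 : E 5 = 0 := by simpa [w₆, e4] using h5
    ext i
    fin_cases i <;> assumption
  · set A := closedLoop M m grav l₀ k₁ k₂ k₃ k₄ k₅ k₆ E with hA
    have A0 : A 0 = E 1 := rfl
    have A1 : A 1 = (-(k₁ * E 0 + k₂ * E 1 + k₃ * E 2 + k₄ * E 3) + m * grav * E 2) / M := rfl
    have A2 : A 2 = E 3 := rfl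
    have A3 : A 3 = -(grav / l₀) * E 2 + (k₁ * E 0 + k₂ * E 1 + k₃ * E 2 + k₄ * E 3) / (M * l₀)
       - m * grav / (M * l₀) * E 2 := rfl
    have A4 : A 4 = E 5 := rfl
    have A5 : A 5 = -(k₅ * E 4 + k₆ * E 5) / m := rfl
    have hz : A 1 + l₀ * A 3 = -grav * E 2 := by
      rw [A1, A3]; field_simp; ring
    have hz3 : -grav * A 3 = -(p₃ * (-grav * E 3) + p₂ * (-grav * E 2) + p₁ * (E 1 + l₀ * E 3) +
        p₀ * (E 0 + l₀ * E 2)) := by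
      rw [A3, hp₃, hp₂, hp₁, hp₀]; field_simp; ring
    have W1 : w₁ A = w₂ E - σ * w₁ E := by simp only [w₁, w₂, A0, A2]; ring
    have W2 : w₂ A = w₃ E - β₁ * w₁ E - σ * w₂ E := by
      simp only [w₁, w₂, w₃, hz, A0, A2]; ring
    have W3 : w₃ A = w₄ E - β₂ * w₂ E - σ * w₃ E := by
      simp only [w₂, w₃, w₄, hz, A0, A2]; ring
    have W4 : w₄ A = -β₃ * w₃ E - α * w₄ E - σ * w₄ E := by
      have e3 : p₃ = α + 4 * σ := by rw [hα]; ring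
      have e2 : p₂ = β₁ + β₂ + β₃ + 3 * p₃ * σ - 6 * σ ^ 2 := by linarith
      have e1 : p₁ = α * (β₁ + β₂) + 2 * p₂ * σ - 3 * p₃ * σ ^ 2 + 4 * σ ^ 3 := by linarith
      have e0 : p₀ = β₁ * β₃ + p₁ * σ - p₂ * σ ^ 2 + p₃ * σ ^ 3 - σ ^ 4 := by linarith
      simp only [w₂, w₃, w₄, hz, hz3, A0, A2]
      rw [e0, e1, e2, e3]; ring
    have W5 : w₅ A = w₆ E - σ * w₅ E := by simp only [w₅, w₆, A4]; ring
    have W6 : w₆ A = -β * w₅ E - (k₆ / m - 2 * σ) * w₆ E - σ * w₆ E := by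
      simp only [w₅, w₆, A4, A5, hβ]; ring
    -- The Schwarz form alone dissipates only `w₄` and `w₆`; the shift contributes the uniform term
    -- `-σ * ‖L E‖ ^ 2`.
    have key : inner ℝ (L E) (L A) = -σ * ‖L E‖ ^ 2 - α * w₄ E ^ 2 -
        (k₆ / m - 2 * σ) * w₆ E ^ 2 := by
      rw [EuclideanSpace.real_norm_sq_eq, PiLp.inner_apply]
      simp only [hL, Fin.sum_univ_six, RCLike.inner_apply, conj_trivial]
      simp [W1, W2, W3, W4, W5, W6]
      linear_combination (w₁ E * w₂ E) * ha₁ + (w₂ E * (w₃ E - β₁ * w₁ E)) * ha₂ +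
        (w₃ E * (w₄ E - β₂ * w₂ E)) * ha₃ + w₅ E * w₆ E * hb₁
    rw [key]
    have := mul_nonneg hαpos.le (sq_nonneg (w₄ E))
    have := mul_nonneg hd₁.le (sq_nonneg (w₆ E))
    linarith

end Linearization

/-! ### The crane field near rest -/

section Field

variable (M m grav : ℝ)

lemma field_eq (X : State) (F : Fin 2 → ℝ) :
    field M m grav X F =
      !₂[X 1,
         F 0 / M - Real.sin (X 2) / M * F 1,
         X 3,
         -(2 / X 4) * X 5 * X 3 - grav / X 4 * Real.sin (X 2) - Real.cos (X 2) / (M * X 4) * F 0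
           + Real.sin (X 2) * Real.cos (X 2) / (M * X 4) * F 1,
         X 5,
         X 4 * X 3 ^ 2 + grav * Real.cos (X 2) - Real.sin (X 2) / M * F 0
           + (Real.sin (X 2) ^ 2 / M + 1 / m) * F 1] := by
  ext i
  fin_cases i <;> simp [field, drift, inputMatrix, dotProduct, Fin.sum_univ_two] <;>
    ring

/-- The field does not depend on the cart position, and on the cart velocity only additively. -/
lemma field_sub_field_congr {X X' : State} (h : ∀ i : Fin 6, 2 ≤ i → X i = X' i) (E E' : State)
    (F F' : Fin 2 → ℝ) :
    field M m grav (X + E) F - field M m grav (X + E') F' =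
      field M m grav (X' + E) F - field M m grav (X' + E') F' := by
  have h2 := h 2 (by decide)
  have h3 := h 3 (by decide)
  have h4 := h 4 (by decide)
  have h5 := h 5 (by decide)
  rw [field_eq, field_eq, field_eq, field_eq]
  ext i
  fin_cases i <;> simp [h2, h3, h4, h5]

lemma contDiffAt_field {X : State} {F : Fin 2 → ℝ} (hM : M ≠ 0) (hl : X 4 ≠ 0) :
    ContDiffAt ℝ 1 (fun q : State × (Fin 2 → ℝ) ↦ field M m grav q.1 q.2) (X, F) := by
  simp only [field_eq]
  rw [contDiffAt_euclidean]
  have hX : ∀ i : Fin 6, ContDiffAt ℝ 1 (fun q : State × (Fin 2 → ℝ) ↦ q.1 i) (X, F) := fun i ↦ by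
    fun_prop
  have hF : ∀ i : Fin 2, ContDiffAt ℝ 1 (fun q : State × (Fin 2 → ℝ) ↦ q.2 i) (X, F) := fun i ↦ by
    fun_prop
  have hsin := (hX 2).sin
  have hcos := (hX 2).cos
  have hMl : ContDiffAt ℝ 1 (fun q : State × (Fin 2 → ℝ) ↦ M * q.1 4) (X, F) :=
    contDiffAt_const.mul (hX 4)
  have hMl0 : M * X 4 ≠ 0 := mul_ne_zero hM hl
  intro i
  fin_cases i
  · exact hX 1
  · exact ((hF 0).div_const M).sub ((hsin.div_const M).mul (hF 1))
  · exact hX 3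
  · exact (((((contDiffAt_const.div (hX 4) hl).neg.mul (hX 5)).mul (hX 3)).sub
      ((contDiffAt_const.div (hX 4) hl).mul hsin)).sub ((hcos.div hMl hMl0).mul (hF 0))).add
      (((hsin.mul hcos).div hMl hMl0).mul (hF 1))
  · exact hX 5
  · exact ((((hX 4).mul ((hX 3).pow 2)).add (contDiffAt_const.mul hcos)).sub
      ((hsin.div_const M).mul (hF 0))).add
      ((((hsin.pow 2).div_const M).add contDiffAt_const).mul (hF 1))

/-- The rest state with payload length `l₀`. -/
def restState (l₀ : ℝ) : State := !₂[0, 0, 0, 0, l₀, 0]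

/-- The input that balances the payload's weight at rest. -/
def restInput : Fin 2 → ℝ := ![0, -m * grav]

/-- The derivative along `(E, -K E)` of the field at rest is the closed-loop linearization. -/
lemma hasDerivAt_field_rest (hM : M ≠ 0) {l₀ : ℝ} (hl₀ : l₀ ≠ 0) (k₁ k₂ k₃ k₄ k₅ k₆ : ℝ)
    (E : State) (i : Fin 6) :
    HasDerivAt (fun s : ℝ ↦ field M m grav (restState l₀ + s • E)
      (restInput m grav + s • -((gainMatrix k₁ k₂ k₃ k₄ k₅ k₆).mulVec E.ofLp)) i)
      (closedLoop M m grav l₀ k₁ k₂ k₃ k₄ k₅ k₆ E i) 0 := by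
  have hlin : ∀ a b : ℝ, HasDerivAt (fun s : ℝ ↦ a + s * b) b 0 := fun a b ↦ by
    simpa using ((hasDerivAt_id (0 : ℝ)).mul_const b).const_add a
  have hK0 : (gainMatrix k₁ k₂ k₃ k₄ k₅ k₆).mulVec E.ofLp 0 =
      k₁ * E 0 + k₂ * E 1 + k₃ * E 2 + k₄ * E 3 := by
    simp [gainMatrix, Matrix.mulVec, dotProduct, Fin.sum_univ_six]
  have hK1 : (gainMatrix k₁ k₂ k₃ k₄ k₅ k₆).mulVec E.ofLp 1 = k₅ * E 4 + k₆ * E 5 := by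
    simp [gainMatrix, Matrix.mulVec, dotProduct, Fin.sum_univ_six]
  have h1 := hlin 0 (E 1)
  have h2 := hlin 0 (E 2)
  have h3 := hlin 0 (E 3)
  have h4 := hlin l₀ (E 4)
  have h5 := hlin 0 (E 5)
  have f0 := hlin 0 (-(k₁ * E 0 + k₂ * E 1 + k₃ * E 2 + k₄ * E 3))
  have f1 := hlin (-m * grav) (-(k₅ * E 4 + k₆ * E 5))
  have hl : l₀ + 0 * E 4 ≠ 0 := by simpa using hl₀
  have hMl := h4.const_mul M
  have hMl0 : M * (l₀ + 0 * E 4) ≠ 0 := mul_ne_zero hM hl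
  have hs := h2.sin
  have hc := h2.cos
  simp only [field_eq, closedLoop, PiLp.add_apply, PiLp.smul_apply, Pi.add_apply, Pi.smul_apply,
    Pi.neg_apply, hK0, hK1, smul_eq_mul]
  fin_cases i
  · exact h1
  · exact ((f0.div_const M).sub ((hs.div_const M).mul f1)).congr_deriv (by simp; ring)
  · exact h3
  · exact ((((((hasDerivAt_const _ _).div h4 hl).neg.mul h5).mul h3).sub
      (((hasDerivAt_const _ _).div h4 hl).mul hs)).sub ((hc.div hMl hMl0).mul f0)).add
      (((hs.mul hc).div hMl hMl0).mul f1) |>.congr_deriv (by simp; field_simp; ring)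
  · exact h5
  · exact ((((h4.mul (h3.pow 2)).add (hc.const_mul _)).sub ((hs.div_const M).mul f0)).add
      ((((hs.pow 2).div_const M).add_const _).mul f1)).congr_deriv (by simp; ring)

/-- Uniform first-order approximation of the closed-loop field near rest. -/
lemma exists_field_sub_le (hM : M ≠ 0) {l₀ : ℝ} (hl₀ : l₀ ≠ 0) (k₁ k₂ k₃ k₄ k₅ k₆ : ℝ)
    {η : ℝ} (hη : 0 < η) :
    ∃ c > 0, ∃ U ∈ 𝓝 (restState l₀, restInput m grav), ∀ X F, (X, F) ∈ U →
      ∀ E E' : State, ‖E‖ ≤ c → ‖E'‖ ≤ c →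
        X 4 + E 4 ≠ 0 ∧
        ‖field M m grav (X + E) (F + -((gainMatrix k₁ k₂ k₃ k₄ k₅ k₆).mulVec E.ofLp)) -
          field M m grav (X + E') (F + -((gainMatrix k₁ k₂ k₃ k₄ k₅ k₆).mulVec E'.ofLp)) -
          closedLoop M m grav l₀ k₁ k₂ k₃ k₄ k₅ k₆ (E - E')‖ ≤ η * ‖E - E'‖ := by
  set q₀ : State × (Fin 2 → ℝ) := (restState l₀, restInput m grav) with hq₀
  set Φ : State × (Fin 2 → ℝ) → State := fun q ↦ field M m grav q.1 q.2 with hΦ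
  have hX0 : (restState l₀) 4 = l₀ := rfl
  -- Strict differentiability lets both points vary near `q₀`, which makes the estimate uniform in
  -- the base point `(X, F)`.
  obtain ⟨D, hD⟩ : ∃ D, HasStrictFDerivAt Φ D q₀ :=
    ⟨_, (contDiffAt_field M m grav hM (by rwa [hX0])).hasStrictFDerivAt one_ne_zero⟩
  let T : State →L[ℝ] State × (Fin 2 → ℝ) := LinearMap.toContinuousLinearMap
    { toFun := fun E ↦ (E, -((gainMatrix k₁ k₂ k₃ k₄ k₅ k₆).mulVec E.ofLp))
      map_add' := fun E F ↦ by
        ext i <;> simp [Matrix.mulVec_add, add_comm]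
      map_smul' := fun a E ↦ by
        ext i <;> simp [Matrix.mulVec_smul] }
  have hT : ∀ E, T E = (E, -((gainMatrix k₁ k₂ k₃ k₄ k₅ k₆).mulVec E.ofLp)) := fun _ ↦ rfl
  -- `D (T E)` is a directional derivative, so it is identified along the line `q₀ + s • T E`.
  have hDT : ∀ E, D (T E) = closedLoop M m grav l₀ k₁ k₂ k₃ k₄ k₅ k₆ E := by
    intro E
    ext i
    have h1 : HasDerivAt (fun s : ℝ ↦ q₀ + s • T E) (T E) 0 := by
      simpa using ((hasDerivAt_id (0 : ℝ)).smul_const (T E)).const_add q₀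
    have hD' : HasFDerivAt Φ D (q₀ + (0 : ℝ) • T E) := by simpa using hD.hasFDerivAt
    have h2 := hD'.comp_hasDerivAt (0 : ℝ) h1
    have h3 := (EuclideanSpace.proj (𝕜 := ℝ) i).hasFDerivAt.comp_hasDerivAt (0 : ℝ) h2
    exact h3.unique (hasDerivAt_field_rest M m grav hM hl₀ k₁ k₂ k₃ k₄ k₅ k₆ E i)
  have hTn : 0 < ‖T‖ + 1 := by positivity
  have hev := hD.isLittleO.def (div_pos hη hTn)
  have hev2 : ∀ᶠ q in 𝓝 (q₀, q₀), q.1.1 4 ≠ 0 := by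
    have : ContinuousAt (fun q : (State × (Fin 2 → ℝ)) × (State × (Fin 2 → ℝ)) ↦ q.1.1 4)
      (q₀, q₀) := by fun_prop
    exact this.eventually_ne hl₀
  have hmap : Tendsto (fun p : (State × (Fin 2 → ℝ)) × (State × State) ↦
      (p.1 + T p.2.1, p.1 + T p.2.2)) (𝓝 (q₀, (0, 0))) (𝓝 (q₀, q₀)) := by
    have : Continuous (fun p : (State × (Fin 2 → ℝ)) × (State × State) ↦
      (p.1 + T p.2.1, p.1 + T p.2.2)) := by fun_prop
    simpa using this.tendsto (q₀, (0, 0))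
  have hall := hmap.eventually (hev.and hev2)
  rw [nhds_prod_eq] at hall
  obtain ⟨U, hU, W, hW, hUW⟩ := Filter.mem_prod_iff.1 hall
  obtain ⟨c, hc, hcW⟩ := Metric.mem_nhds_iff.1 hW
  refine ⟨c / 2, by positivity, U, hU, fun X F hXF E E' hE hE' ↦ ?_⟩
  have hmem : (((X, F), (E, E')) : (State × (Fin 2 → ℝ)) × (State × State)) ∈ U ×ˢ W := by
    refine ⟨hXF, hcW ?_⟩
    rw [Metric.mem_ball, Prod.dist_eq]
    simp only [dist_zero_right]
    exact max_lt (by linarith) (by linarith)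
  obtain ⟨h1, h2⟩ := hUW hmem
  refine ⟨h2, ?_⟩
  have e1 : ((X, F) + T E) - ((X, F) + T E') = T (E - E') := by
    rw [map_sub]; abel
  dsimp only at h1
  rw [e1, hDT] at h1
  refine h1.trans ?_
  rw [div_mul_eq_mul_div, div_le_iff₀ hTn, mul_assoc, mul_comm _ (‖T‖ + 1)]
  gcongr
  exact (T.le_opNorm _).trans (by gcongr; linarith)

end Field

/-! ### Stability of the error dynamics along slowly varying equilibria near rest -/

section Tracking

variable (M m grav : ℝ)

/-- Linearity in finite dimension. The constant enters the uniform Lipschitz bound of the error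
field. -/
lemma exists_norm_closedLoop_le (l₀ k₁ k₂ k₃ k₄ k₅ k₆ : ℝ) :
    ∃ C : ℝ≥0, ∀ E, ‖closedLoop M m grav l₀ k₁ k₂ k₃ k₄ k₅ k₆ E‖ ≤ C * ‖E‖ := by
  let A : State →L[ℝ] State := LinearMap.toContinuousLinearMap
    { toFun := closedLoop M m grav l₀ k₁ k₂ k₃ k₄ k₅ k₆
      map_add' := fun E F ↦ by
        ext i; fin_cases i <;> simp [closedLoop] <;> ring
      map_smul' := fun a E ↦ by
        ext i; fin_cases i <;> simp [closedLoop] <;> ring }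
  exact ⟨‖A‖₊, fun E ↦ A.le_opNorm E⟩

lemma continuousWithinAt_field (hM : M ≠ 0) {X : ℝ → State} {F : ℝ → Fin 2 → ℝ} {s : Set ℝ}
    {t : ℝ} (hX : ContinuousWithinAt X s t) (hF : ContinuousWithinAt F s t) (hl : X t 4 ≠ 0) :
    ContinuousWithinAt (fun t ↦ field M m grav (X t) (F t)) s t :=
  (contDiffAt_field M m grav hM hl).continuousAt.comp_continuousWithinAt
    (f := fun t ↦ (X t, F t)) (hX.prodMk hF)

/-- If the desired state solves the crane dynamics under the feedforward input and stays close to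
rest, up to the cart motion, then the origin is exponentially stable for the error dynamics. -/
theorem exists_nhds_isExponentiallyStableOrigin_errorField (hM : 0 < M) (hm : 0 < m)
    (hgrav : 0 < grav) {l₀ : ℝ} (hl₀ : 0 < l₀) {k₁ k₂ k₃ k₄ k₅ k₆ : ℝ}
    (hK : StabilizingGains M m grav l₀ k₁ k₂ k₃ k₄ k₅ k₆) :
    ∃ U ∈ 𝓝 (restState l₀, restInput m grav),
      ∀ (Xd X : ℝ → State) (Fff : ℝ → Fin 2 → ℝ),
        (∀ t, 0 ≤ t → ∀ i : Fin 6, 2 ≤ i → Xd t i = X t i) →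
        ContinuousOn X (Ici 0) → ContinuousOn Fff (Ici 0) →
        (∀ t, 0 ≤ t → (X t, Fff t) ∈ U) →
        (∀ t, 0 ≤ t → deriv Xd t = field M m grav (Xd t) (Fff t)) →
        IsExponentiallyStableOrigin
          (errorField M m grav (gainMatrix k₁ k₂ k₃ k₄ k₅ k₆) Xd Fff) := by
  obtain ⟨L, hker, σ, hσ, hL⟩ := exists_lyapunov_closedLoop hM hm hgrav hl₀ hK
  obtain ⟨N, hN, hanti⟩ := L.exists_antilipschitzWith hker
  obtain ⟨C, hC⟩ := exists_norm_closedLoop_le M m grav l₀ k₁ k₂ k₃ k₄ k₅ k₆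
  set Lc : State →L[ℝ] State := LinearMap.toContinuousLinearMap L with hLc
  have hNpos : (0 : ℝ) < N := hN
  have hκ : 0 < (N : ℝ)⁻¹ := by positivity
  have hκL : ∀ e, (N : ℝ)⁻¹ * ‖e‖ ≤ ‖Lc e‖ := fun e ↦ by
    have := hanti.le_mul_dist e 0
    rw [map_zero, dist_zero_right, dist_zero_right] at this
    rwa [inv_mul_le_iff₀ hNpos]
  -- Chosen so that the image under `Lc` of the nonlinear remainder is at most `σ / 2 * ‖Lc E‖`,
  -- leaving half of the dissipation.
  have hη : 0 < σ * (N : ℝ)⁻¹ / (2 * (‖Lc‖ + 1)) := by positivity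
  obtain ⟨c, hc, U, hU, hfield⟩ := exists_field_sub_le M m grav hM.ne' hl₀.ne' k₁ k₂ k₃ k₄ k₅ k₆ hη
  set η := σ * (N : ℝ)⁻¹ / (2 * (‖Lc‖ + 1)) with hηdef
  refine ⟨U, hU, fun Xd X Fff hXd hXc hFc hmem heq ↦ ?_⟩
  set φ := errorField M m grav (gainMatrix k₁ k₂ k₃ k₄ k₅ k₆) Xd Fff with hφ
  -- The reference equation turns `deriv Xd` into a value of the field; in the difference the cart
  -- motion cancels, so `Xd` may be replaced by `X`.
  have hφeq : ∀ t, 0 ≤ t → ∀ E, φ t E = field M m grav (X t + E)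
      (Fff t + -((gainMatrix k₁ k₂ k₃ k₄ k₅ k₆).mulVec E.ofLp)) -
        field M m grav (X t) (Fff t) := by
    intro t ht E
    have := field_sub_field_congr M m grav (hXd t ht) E 0
      (Fff t + -((gainMatrix k₁ k₂ k₃ k₄ k₅ k₆).mulVec E.ofLp)) (Fff t)
    rw [add_zero, add_zero] at this
    rw [← this, ← heq t ht]
    rfl
  have hzero : ∀ t, 0 ≤ t → φ t 0 = 0 := fun t ht ↦ by
    rw [hφeq t ht]
    simp
  have hdiff : ∀ t, 0 ≤ t → ∀ E E' : State, ‖E‖ ≤ c → ‖E'‖ ≤ c →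
      ‖φ t E - φ t E' - closedLoop M m grav l₀ k₁ k₂ k₃ k₄ k₅ k₆ (E - E')‖ ≤ η * ‖E - E'‖ := by
    intro t ht E E' hE hE'
    rw [hφeq t ht, hφeq t ht, sub_sub_sub_cancel_right]
    exact (hfield _ _ (hmem t ht) E E' hE hE').2
  refine isExponentiallyStableOrigin_of_dissipative (L := Lc) (κ := (N : ℝ)⁻¹) (c := c)
    (r := σ / 2) (K := C + ⟨η, hη.le⟩) hκ hκL (by positivity) hc hzero ?_ ?_ ?_
  · intro t ht E E' hE hE'
    have h1 := hdiff t ht E E' hE hE'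
    have h2 := hC (E - E')
    calc ‖φ t E - φ t E'‖ = ‖closedLoop M m grav l₀ k₁ k₂ k₃ k₄ k₅ k₆ (E - E') +
          (φ t E - φ t E' - closedLoop M m grav l₀ k₁ k₂ k₃ k₄ k₅ k₆ (E - E'))‖ := by
            rw [add_sub_cancel]
      _ ≤ C * ‖E - E'‖ + η * ‖E - E'‖ := (norm_add_le _ _).trans (add_le_add h2 h1)
      _ = _ := by rw [← add_mul]; rfl
  · intro E hE
    refine ContinuousOn.congr (f := fun t ↦ field M m grav (X t + E)
      (Fff t + -((gainMatrix k₁ k₂ k₃ k₄ k₅ k₆).mulVec E.ofLp)) -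
        field M m grav (X t) (Fff t)) (fun t ht ↦ ?_) (fun t ht ↦ hφeq t ht E)
    have hX := hXc t ht
    have hF := hFc t ht
    have h1 := (hfield _ _ (hmem t ht) E E hE hE).1
    have h2 : X t 4 ≠ 0 := by
      simpa using (hfield _ _ (hmem t ht) 0 0 (by simpa using hc.le) (by simpa using hc.le)).1
    exact (continuousWithinAt_field M m grav hM.ne' (hX.add continuousWithinAt_const)
      (hF.add continuousWithinAt_const) h1).sub (continuousWithinAt_field M m grav hM.ne' hX hF h2)
  · intro t ht E hE
    have h1 := hdiff t ht E 0 hE (by simpa using hc.le)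
    rw [hzero t ht, sub_zero, sub_zero] at h1
    set R := φ t E - closedLoop M m grav l₀ k₁ k₂ k₃ k₄ k₅ k₆ E with hR
    have h2 : φ t E = closedLoop M m grav l₀ k₁ k₂ k₃ k₄ k₅ k₆ E + R := by
      rw [hR, add_sub_cancel]
    have h3 : ‖Lc R‖ ≤ σ / 2 * ‖Lc E‖ := by
      calc ‖Lc R‖ ≤ ‖Lc‖ * ‖R‖ := Lc.le_opNorm R
        _ ≤ (‖Lc‖ + 1) * (η * ‖E‖) := by gcongr; linarith
        _ = σ / 2 * ((N : ℝ)⁻¹ * ‖E‖) := by rw [hηdef]; field_simp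
        _ ≤ _ := by gcongr; exact hκL E
    have h4 := real_inner_le_norm (Lc E) (Lc R)
    have h5 := hL E
    have h6 := mul_le_mul_of_nonneg_left h3 (norm_nonneg (Lc E))
    rw [h2, map_add, inner_add_right]
    change inner ℝ (Lc E) (Lc _) ≤ -σ * ‖Lc E‖ ^ 2 at h5
    nlinarith

end Tracking

/-! ### The desired trajectory solves the crane dynamics under the feedforward input -/

section Reference

variable {grav : ℝ} {Y : ℝ → Output}

lemma contDiff_yd (hY : ContDiff ℝ 4 Y) (n i : ℕ) (h : n + i = 4) (j : Fin 2) :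
    ContDiff ℝ n (yd Y i j) := by
  have h1 : ContDiff ℝ n (iteratedDeriv i Y) := by
    rw [iteratedDeriv_eq_iterate]
    refine ContDiff.iterate_deriv' n i ?_
    rw [h]
    exact_mod_cast hY
  exact contDiff_euclidean.1 h1 j

lemma continuous_yd (hY : ContDiff ℝ 4 Y) (i : ℕ) (h : i ≤ 4) (j : Fin 2) :
    Continuous (yd Y i j) :=
  (contDiff_yd hY (4 - i) i (by omega) j).continuous

lemma hasDerivAt_yd (hY : ContDiff ℝ 4 Y) (i : ℕ) (h : i < 4) (j : Fin 2) (t : ℝ) :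
    HasDerivAt (yd Y i j) (yd Y (i + 1) j t) t := by
  have h1 : HasDerivAt (iteratedDeriv i Y) (iteratedDeriv (i + 1) Y t) t := by
    rw [iteratedDeriv_succ]
    exact ((hY.differentiable_iteratedDeriv i (by exact_mod_cast h)) t).hasDerivAt
  exact (EuclideanSpace.proj (𝕜 := ℝ) j).hasFDerivAt.comp_hasDerivAt t h1

variable (grav Y) in
/-- The times at which the payload is below the cart and falls slower than freely. -/
def regularTimes : Set ℝ := {t | 0 < yd Y 2 1 t + grav ∧ yd Y 0 1 t < 0}

lemma isOpen_regularTimes (hY : ContDiff ℝ 4 Y) : IsOpen (regularTimes grav Y) :=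
  (isOpen_lt continuous_const ((continuous_yd hY 2 (by norm_num) 1).add continuous_const)).inter
    (isOpen_lt (continuous_yd hY 0 (by norm_num) 1) continuous_const)

lemma cos_thetad_pos (t : ℝ) : 0 < Real.cos (thetad grav Y t) := Real.cos_arctan_pos _

lemma sin_thetad (t : ℝ) : Real.sin (thetad grav Y t) =
    -yd Y 2 0 t / (yd Y 2 1 t + grav) * Real.cos (thetad grav Y t) := by
  have h := Real.tan_arctan (-yd Y 2 0 t / (yd Y 2 1 t + grav))
  rw [Real.tan_eq_sin_div_cos, div_eq_iff (Real.cos_arctan_pos _).ne'] at h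
  exact h

variable {t : ℝ}

/-- The component of payload acceleration plus gravity across the cable vanishes by the choice of
the swing angle. Differentiating this once and twice yields the angular velocity and acceleration.
-/
lemma cos_mul_add_sin_mul_eq_zero (ht : t ∈ regularTimes grav Y) :
    Real.cos (thetad grav Y t) * yd Y 2 0 t +
      Real.sin (thetad grav Y t) * (yd Y 2 1 t + grav) = 0 := by
  have := ht.1.ne'
  rw [sin_thetad]
  field_simp
  ring

/-- The sum under the root is `y₂² (1 + tan² θ_d)`, and the sign of `y₂` selects the root. -/
lemma ld_eq (ht : t ∈ regularTimes grav Y) :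
    ld grav Y t = -yd Y 0 1 t / Real.cos (thetad grav Y t) := by
  have hc := cos_thetad_pos (grav := grav) (Y := Y) t
  have hb := ht.1.ne'
  have hsq : (yd Y 2 0 t * yd Y 0 1 t / (yd Y 2 1 t + grav)) ^ 2 + yd Y 0 1 t ^ 2 =
      (-yd Y 0 1 t / Real.cos (thetad grav Y t)) ^ 2 := by
    have h1 := Real.sin_sq_add_cos_sq (thetad grav Y t)
    rw [sin_thetad] at h1
    have h2 : (yd Y 2 0 t * yd Y 0 1 t / (yd Y 2 1 t + grav)) ^ 2 + yd Y 0 1 t ^ 2 =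
      ((-yd Y 2 0 t / (yd Y 2 1 t + grav)) ^ 2 + 1) * yd Y 0 1 t ^ 2 := by ring
    rw [h2, div_pow (-yd Y 0 1 t), eq_div_iff (by positivity)]
    linear_combination yd Y 0 1 t ^ 2 * h1
  rw [ld, hsq, Real.sqrt_sq (div_nonneg (by linarith [ht.2]) hc.le)]

lemma ld_pos (ht : t ∈ regularTimes grav Y) : 0 < ld grav Y t := by
  rw [ld_eq ht]
  exact div_pos (by linarith [ht.2]) (cos_thetad_pos t)

lemma yd_eq_neg_ld_mul_cos (ht : t ∈ regularTimes grav Y) :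
    yd Y 0 1 t = -(ld grav Y t * Real.cos (thetad grav Y t)) := by
  have hc := (cos_thetad_pos (grav := grav) (Y := Y) t).ne'
  rw [ld_eq ht]
  field_simp

lemma xd_eq (ht : t ∈ regularTimes grav Y) :
    xd grav Y t = yd Y 0 0 t - ld grav Y t * Real.sin (thetad grav Y t) := by
  have hc := (cos_thetad_pos (grav := grav) (Y := Y) t).ne'
  rw [xd, ld_eq ht, sin_thetad]
  field_simp

lemma contDiffAt_thetad (hY : ContDiff ℝ 4 Y) (ht : t ∈ regularTimes grav Y) :
    ContDiffAt ℝ 2 (thetad grav Y) t :=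
  (((contDiff_yd hY 2 2 rfl 0).contDiffAt.neg.div
    ((contDiff_yd hY 2 2 rfl 1).contDiffAt.add contDiffAt_const) ht.1.ne')).arctan

lemma contDiffAt_ld (hY : ContDiff ℝ 4 Y) (ht : t ∈ regularTimes grav Y) :
    ContDiffAt ℝ 2 (ld grav Y) t := by
  have h0 : ContDiffAt ℝ 2 (yd Y 0 1) t := (contDiff_yd hY 4 0 rfl 1).contDiffAt.of_le (by norm_num)
  refine (((((contDiff_yd hY 2 2 rfl 0).contDiffAt.mul h0).div
    ((contDiff_yd hY 2 2 rfl 1).contDiffAt.add contDiffAt_const) ht.1.ne').pow 2).add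
    (h0.pow 2)).sqrt ?_
  have := ht.2.ne
  positivity

lemma contDiffAt_xd (hY : ContDiff ℝ 4 Y) (ht : t ∈ regularTimes grav Y) :
    ContDiffAt ℝ 2 (xd grav Y) t := by
  have h0 : ∀ j, ContDiffAt ℝ 2 (yd Y 0 j) t := fun j ↦
    (contDiff_yd hY 4 0 rfl j).contDiffAt.of_le (by norm_num)
  exact (h0 0).sub (((contDiff_yd hY 2 2 rfl 0).contDiffAt.mul (h0 1)).div
    ((contDiff_yd hY 2 2 rfl 1).contDiffAt.add contDiffAt_const) ht.1.ne')

lemma hasDerivAt_of_contDiffAt_two {f : ℝ → ℝ} (h : ContDiffAt ℝ 2 f t) :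
    HasDerivAt f (deriv f t) t ∧ HasDerivAt (deriv f) (deriv (deriv f) t) t := by
  refine ⟨(h.differentiableAt (by norm_num)).hasDerivAt, ?_⟩
  exact ((h.derivWithin (m := 1) (by norm_num)).differentiableAt (by norm_num)).hasDerivAt

/-- Two functions that agree at all regular times have the same derivative there. -/
lemma deriv_eq_of_eqOn_regularTimes (hY : ContDiff ℝ 4 Y) {P Q : ℝ → ℝ} {p q : ℝ}
    (ht : t ∈ regularTimes grav Y) (hPQ : ∀ s ∈ regularTimes grav Y, P s = Q s)
    (hP : HasDerivAt P p t) (hQ : HasDerivAt Q q t) : p = q :=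
  -- Openness of the regular set makes the identity hold on a full neighbourhood of `t`, including
  -- when `t = 0`.
  (hP.congr_of_eventuallyEq
    (((isOpen_regularTimes hY).mem_nhds ht |> fun h ↦ by
      filter_upwards [h] with s hs using (hPQ s hs).symm))).unique hQ

lemma cos_mul_add_sin_mul_deriv (hY : ContDiff ℝ 4 Y) (ht : t ∈ regularTimes grav Y) :
    Real.cos (thetad grav Y t) * yd Y 3 0 t + Real.sin (thetad grav Y t) * yd Y 3 1 t =
      deriv (thetad grav Y) t * (Real.sin (thetad grav Y t) * yd Y 2 0 t -
        Real.cos (thetad grav Y t) * (yd Y 2 1 t + grav)) := by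
  have hθ := (hasDerivAt_of_contDiffAt_two (contDiffAt_thetad hY ht)).1
  have ha := hasDerivAt_yd hY 2 (by norm_num) 0 t
  have hb := (hasDerivAt_yd hY 2 (by norm_num) 1 t).add_const grav
  have h := deriv_eq_of_eqOn_regularTimes hY ht (fun s hs ↦ cos_mul_add_sin_mul_eq_zero hs)
    ((hθ.cos.mul ha).add (hθ.sin.mul hb)) (hasDerivAt_const t 0)
  linear_combination h

lemma cos_mul_add_sin_mul_deriv_two (hY : ContDiff ℝ 4 Y) (ht : t ∈ regularTimes grav Y) :
    Real.cos (thetad grav Y t) * yd Y 4 0 t + Real.sin (thetad grav Y t) * yd Y 4 1 t =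
      2 * deriv (thetad grav Y) t * (Real.sin (thetad grav Y t) * yd Y 3 0 t -
        Real.cos (thetad grav Y t) * yd Y 3 1 t) +
      deriv (deriv (thetad grav Y)) t * (Real.sin (thetad grav Y t) * yd Y 2 0 t -
        Real.cos (thetad grav Y t) * (yd Y 2 1 t + grav)) := by
  obtain ⟨hθ, hθ'⟩ := hasDerivAt_of_contDiffAt_two (contDiffAt_thetad hY ht)
  have ha := hasDerivAt_yd hY 2 (by norm_num) 0 t
  have hb := (hasDerivAt_yd hY 2 (by norm_num) 1 t).add_const grav
  have ha' := hasDerivAt_yd hY 3 (by norm_num) 0 t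
  have hb' := hasDerivAt_yd hY 3 (by norm_num) 1 t
  have h := deriv_eq_of_eqOn_regularTimes hY ht (fun s hs ↦ cos_mul_add_sin_mul_deriv hY hs)
    ((hθ.cos.mul ha').add (hθ.sin.mul hb')) (hθ'.mul ((hθ.sin.mul ha).sub (hθ.cos.mul hb)))
  linear_combination h + deriv (thetad grav Y) t ^ 2 * cos_mul_add_sin_mul_eq_zero ht

lemma yd_one_eq (hY : ContDiff ℝ 4 Y) (ht : t ∈ regularTimes grav Y) :
    yd Y 1 1 t = -(deriv (ld grav Y) t * Real.cos (thetad grav Y t)) +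
      ld grav Y t * (Real.sin (thetad grav Y t) * deriv (thetad grav Y) t) := by
  have hθ := (hasDerivAt_of_contDiffAt_two (contDiffAt_thetad hY ht)).1
  have hl := (hasDerivAt_of_contDiffAt_two (contDiffAt_ld hY ht)).1
  have h := deriv_eq_of_eqOn_regularTimes hY ht (fun s hs ↦ yd_eq_neg_ld_mul_cos hs)
    (hasDerivAt_yd hY 0 (by norm_num) 1 t) (hl.mul hθ.cos).neg
  linear_combination h

lemma yd_two_eq (hY : ContDiff ℝ 4 Y) (ht : t ∈ regularTimes grav Y) :
    yd Y 2 1 t = -(deriv (deriv (ld grav Y)) t * Real.cos (thetad grav Y t)) +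
      2 * deriv (ld grav Y) t * (Real.sin (thetad grav Y t) * deriv (thetad grav Y) t) +
      ld grav Y t * (Real.cos (thetad grav Y t) * deriv (thetad grav Y) t ^ 2 +
        Real.sin (thetad grav Y t) * deriv (deriv (thetad grav Y)) t) := by
  obtain ⟨hθ, hθ'⟩ := hasDerivAt_of_contDiffAt_two (contDiffAt_thetad hY ht)
  obtain ⟨hl, hl'⟩ := hasDerivAt_of_contDiffAt_two (contDiffAt_ld hY ht)
  have h := deriv_eq_of_eqOn_regularTimes hY ht (fun s hs ↦ yd_one_eq hY hs)
    (hasDerivAt_yd hY 1 (by norm_num) 1 t)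
    ((hl'.mul hθ.cos).neg.add (hl.mul (hθ.sin.mul hθ')))
  linear_combination h

lemma deriv_xd_eq (hY : ContDiff ℝ 4 Y) (ht : t ∈ regularTimes grav Y) :
    deriv (xd grav Y) t = yd Y 1 0 t - (deriv (ld grav Y) t * Real.sin (thetad grav Y t) +
      ld grav Y t * (Real.cos (thetad grav Y t) * deriv (thetad grav Y) t)) := by
  have hθ := (hasDerivAt_of_contDiffAt_two (contDiffAt_thetad hY ht)).1
  have hl := (hasDerivAt_of_contDiffAt_two (contDiffAt_ld hY ht)).1
  exact deriv_eq_of_eqOn_regularTimes hY ht (fun s hs ↦ xd_eq hs)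
    (hasDerivAt_of_contDiffAt_two (contDiffAt_xd hY ht)).1
    ((hasDerivAt_yd hY 0 (by norm_num) 0 t).sub (hl.mul hθ.sin))

lemma deriv_deriv_xd_eq (hY : ContDiff ℝ 4 Y) (ht : t ∈ regularTimes grav Y) :
    deriv (deriv (xd grav Y)) t = yd Y 2 0 t -
      (deriv (deriv (ld grav Y)) t * Real.sin (thetad grav Y t) +
      2 * deriv (ld grav Y) t * (Real.cos (thetad grav Y t) * deriv (thetad grav Y) t) +
      ld grav Y t * (-Real.sin (thetad grav Y t) * deriv (thetad grav Y) t ^ 2 +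
        Real.cos (thetad grav Y t) * deriv (deriv (thetad grav Y)) t)) := by
  obtain ⟨hθ, hθ'⟩ := hasDerivAt_of_contDiffAt_two (contDiffAt_thetad hY ht)
  obtain ⟨hl, hl'⟩ := hasDerivAt_of_contDiffAt_two (contDiffAt_ld hY ht)
  have h := deriv_eq_of_eqOn_regularTimes hY ht (fun s hs ↦ deriv_xd_eq hY hs)
    (hasDerivAt_of_contDiffAt_two (contDiffAt_xd hY ht)).2
    ((hasDerivAt_yd hY 1 (by norm_num) 0 t).sub
      ((hl'.mul hθ.sin).add (hl.mul (hθ.cos.mul hθ'))))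
  linear_combination h

lemma hasDerivAt_Xd (hY : ContDiff ℝ 4 Y) (ht : t ∈ regularTimes grav Y) :
    HasDerivAt (Xd grav Y)
      !₂[deriv (xd grav Y) t, deriv (deriv (xd grav Y)) t,
         deriv (thetad grav Y) t, deriv (deriv (thetad grav Y)) t,
         deriv (ld grav Y) t, deriv (deriv (ld grav Y)) t] t := by
  obtain ⟨hθ, hθ'⟩ := hasDerivAt_of_contDiffAt_two (contDiffAt_thetad hY ht)
  obtain ⟨hl, hl'⟩ := hasDerivAt_of_contDiffAt_two (contDiffAt_ld hY ht)
  obtain ⟨hx, hx'⟩ := hasDerivAt_of_contDiffAt_two (contDiffAt_xd hY ht)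
  have h : HasDerivAt (fun t ↦ (Xd grav Y t).ofLp)
      ![deriv (xd grav Y) t, deriv (deriv (xd grav Y)) t,
         deriv (thetad grav Y) t, deriv (deriv (thetad grav Y)) t,
         deriv (ld grav Y) t, deriv (deriv (ld grav Y)) t] t := by
    rw [hasDerivAt_pi]
    intro i
    fin_cases i
    exacts [hx, hx', hθ, hθ', hl, hl']
  exact (EuclideanSpace.equiv (Fin 6) ℝ).symm.hasFDerivAt.comp_hasDerivAt t h

/-- The payload force is determined by the desired output. -/
lemma IsFeedforwardF2.eq {m : ℝ} {f₂ f₂' : ℝ → ℝ} (h : IsFeedforwardF2 m grav Y f₂ f₂')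
    (hY : ContDiff ℝ 4 Y) (hreg : ∀ t, 0 ≤ t → t ∈ regularTimes grav Y) (ht : 0 ≤ t) :
    f₂ t = m * (Real.sin (thetad grav Y t) * yd Y 2 0 t
        - Real.cos (thetad grav Y t) * (yd Y 2 1 t + grav)) ∧
      f₂' t = m * (Real.sin (thetad grav Y t) * yd Y 3 0 t
        - Real.cos (thetad grav Y t) * yd Y 3 1 t) := by
  -- The deviations satisfy `u' = v`, `v' = θ_d'² u` with zero initial data, so Grönwall on the pair
  -- makes them vanish.
  set u : ℝ → ℝ := fun t ↦ f₂ t - m * (Real.sin (thetad grav Y t) * yd Y 2 0 t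
    - Real.cos (thetad grav Y t) * (yd Y 2 1 t + grav)) with hu
  set v : ℝ → ℝ := fun t ↦ f₂' t - m * (Real.sin (thetad grav Y t) * yd Y 3 0 t
    - Real.cos (thetad grav Y t) * yd Y 3 1 t) with hv
  have hu' : ∀ s, 0 ≤ s → HasDerivWithinAt u (v s) (Ici 0) s := by
    intro s hs
    have hθ := (hasDerivAt_of_contDiffAt_two (contDiffAt_thetad hY (hreg s hs))).1
    have ha := hasDerivAt_yd hY 2 (by norm_num) 0 s
    have hb := (hasDerivAt_yd hY 2 (by norm_num) 1 s).add_const grav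
    refine ((h.hasDeriv s hs).sub
      (((hθ.sin.mul ha).sub (hθ.cos.mul hb)).const_mul m).hasDerivWithinAt).congr_deriv ?_
    simp only [hv]
    linear_combination (-m * deriv (thetad grav Y) s) * cos_mul_add_sin_mul_eq_zero (hreg s hs)
  have hv' : ∀ s, 0 ≤ s →
      HasDerivWithinAt v (deriv (thetad grav Y) s ^ 2 * u s) (Ici 0) s := by
    intro s hs
    have hθ := (hasDerivAt_of_contDiffAt_two (contDiffAt_thetad hY (hreg s hs))).1
    have ha := hasDerivAt_yd hY 3 (by norm_num) 0 s
    have hb := hasDerivAt_yd hY 3 (by norm_num) 1 s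
    refine ((h.hasDeriv' s hs).sub
      (((hθ.sin.mul ha).sub (hθ.cos.mul hb)).const_mul m).hasDerivWithinAt).congr_deriv ?_
    simp only [hu]
    linear_combination (-m * deriv (thetad grav Y) s) * cos_mul_add_sin_mul_deriv hY (hreg s hs)
  have hθc : ContinuousOn (fun s ↦ deriv (thetad grav Y) s) (Icc 0 t) := fun s hs ↦
    (hasDerivAt_of_contDiffAt_two
      (contDiffAt_thetad hY (hreg s hs.1))).2.continuousAt.continuousWithinAt
  obtain ⟨B, hB⟩ := isCompact_Icc.exists_bound_of_continuousOn (hθc.pow 2)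
  have hw' : ∀ s, 0 ≤ s → HasDerivWithinAt (fun s ↦ (u s, v s))
      (v s, deriv (thetad grav Y) s ^ 2 * u s) (Ici 0) s := fun s hs ↦
    (hu' s hs).prodMk (hv' s hs)
  have hzero := eq_zero_of_abs_deriv_le_mul_abs_self_of_eq_zero_right (a := 0) (b := t)
    (K := max 1 B) (fun s hs ↦ ((hw' s hs.1).continuousWithinAt).mono fun r hr ↦ hr.1)
    (fun s hs ↦ (hw' s hs.1).mono (Ici_subset_Ici.2 hs.1))
    (by simp [hu, hv, h.init, h.init'])
    (fun s hs ↦ by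
      have h1 : |u s| ≤ ‖(u s, v s)‖ := norm_fst_le (u s, v s)
      have h2 : |v s| ≤ ‖(u s, v s)‖ := norm_snd_le (u s, v s)
      have h3 := hB s ⟨hs.1, hs.2.le⟩
      rw [Prod.norm_def (v s, _)]
      refine max_le ?_ ?_
      · exact h2.trans (le_mul_of_one_le_left (norm_nonneg _) (le_max_left _ _))
      · dsimp only
        rw [norm_mul]
        exact mul_le_mul (h3.trans (le_max_right _ _)) h1 (norm_nonneg _)
          (zero_le_one.trans (le_max_left _ _))) t ⟨ht, le_rfl⟩
  have hz := Prod.ext_iff.1 hzero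
  exact ⟨sub_eq_zero.1 hz.1, sub_eq_zero.1 hz.2⟩

/-- Vertical force balance of the payload. It keeps `f₂` away from zero and eliminates it from the
length equation. -/
lemma cos_mul_payloadForce (m : ℝ) (ht : t ∈ regularTimes grav Y) :
    Real.cos (thetad grav Y t) * (m * (Real.sin (thetad grav Y t) * yd Y 2 0 t
      - Real.cos (thetad grav Y t) * (yd Y 2 1 t + grav))) = -m * (yd Y 2 1 t + grav) := by
  linear_combination m * Real.sin (thetad grav Y t) * cos_mul_add_sin_mul_eq_zero ht -
    m * (yd Y 2 1 t + grav) * Real.sin_sq_add_cos_sq (thetad grav Y t)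

/-- The desired state solves the crane dynamics under the feedforward input. -/
theorem deriv_Xd_eq_field {M m : ℝ} (hM : 0 < M) (hm : 0 < m) {f₂ f₂' : ℝ → ℝ}
    (h : IsFeedforwardF2 m grav Y f₂ f₂') (hY : ContDiff ℝ 4 Y)
    (hreg : ∀ t, 0 ≤ t → t ∈ regularTimes grav Y) (ht : 0 ≤ t) :
    deriv (Xd grav Y) t = field M m grav (Xd grav Y t) (feedforward M m grav Y f₂ f₂' t) := by
  have hr := hreg t ht
  obtain ⟨hf, hf'⟩ := h.eq hY hreg ht
  have h0 := cos_mul_add_sin_mul_eq_zero hr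
  have h2 := cos_mul_add_sin_mul_deriv_two hY hr
  have hy := yd_two_eq hY hr
  have hx := deriv_deriv_xd_eq hY hr
  have hcf := cos_mul_payloadForce m hr
  have hc := cos_thetad_pos (grav := grav) (Y := Y) t
  have hl := ld_pos hr
  have hsc := Real.sin_sq_add_cos_sq (thetad grav Y t)
  rw [(hasDerivAt_Xd hY hr).deriv, field_eq]
  have hF1 : feedforward M m grav Y f₂ f₂' t 0 = feedforwardF1 M m grav Y f₂ f₂' t := rfl
  have hF2 : feedforward M m grav Y f₂ f₂' t 1 = f₂ t := rfl
  have hX2 : Xd grav Y t 2 = thetad grav Y t := rfl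
  have hX3 : Xd grav Y t 3 = deriv (thetad grav Y) t := rfl
  have hX4 : Xd grav Y t 4 = ld grav Y t := rfl
  have hX5 : Xd grav Y t 5 = deriv (ld grav Y) t := rfl
  have hX1 : Xd grav Y t 1 = deriv (xd grav Y) t := rfl
  rw [hF1, hF2, hX1, hX2, hX3, hX4, hX5]
  have hf1def : feedforwardF1 M m grav Y f₂ f₂' t = M * ld grav Y t /
      (f₂ t * Real.cos (thetad grav Y t)) *
    (-m * (Real.cos (thetad grav Y t) * yd Y 4 0 t + Real.sin (thetad grav Y t) * yd Y 4 1 t)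
      + 2 * f₂' t * deriv (thetad grav Y) t
      + 1 / (M * ld grav Y t) * f₂ t ^ 2 * Real.sin (thetad grav Y t) * Real.cos (thetad grav Y t)
      - 2 / ld grav Y t * f₂ t * deriv (ld grav Y) t * deriv (thetad grav Y) t
      - grav / ld grav Y t * f₂ t * Real.sin (thetad grav Y t)) := rfl
  set f₁ := feedforwardF1 M m grav Y f₂ f₂' t
  set s := Real.sin (thetad grav Y t)
  set c := Real.cos (thetad grav Y t)
  set l := ld grav Y t
  set l' := deriv (ld grav Y) t
  set l'' := deriv (deriv (ld grav Y)) t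
  set θ' := deriv (thetad grav Y) t
  set θ'' := deriv (deriv (thetad grav Y)) t
  set x'' := deriv (deriv (xd grav Y)) t
  set a := yd Y 2 0 t
  set b := yd Y 2 1 t
  rw [← hf] at hcf
  have hf0 : f₂ t ≠ 0 := by
    intro h0'
    rw [h0', mul_zero] at hcf
    have := mul_pos hm hr.1
    linarith
  have key : m * (c * yd Y 4 0 t + s * yd Y 4 1 t) = 2 * f₂' t * θ' + θ'' * f₂ t := by
    rw [h2, hf, hf']; ring
  -- The definition of `f₁` is the swing equation solved for `f₁`, once the fourth derivatives are
  -- traded for `θ''`. The cart and length equations are checked after multiplication by `c`, so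
  -- that `f₁` enters only through `c * f₁`.
  have hcf1 : c * f₁ = -M * (l * θ'' + 2 * l' * θ' + grav * s) + c * s * f₂ t := by
    rw [hf1def, neg_mul, key]
    field_simp
    ring
  have hθeq : θ'' = -(2 / l) * l' * θ' - grav / l * s - c / (M * l) * f₁
      + s * c / (M * l) * f₂ t := by
    rw [div_mul_eq_mul_div c, hcf1]
    field_simp
    ring
  have hxeq : x'' = f₁ / M - s / M * f₂ t := by
    apply mul_left_cancel₀ hc.ne'
    have : c * (f₁ / M - s / M * f₂ t) = (c * f₁ - c * s * f₂ t) / M := by ring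
    rw [this, hcf1, hx]
    field_simp
    linear_combination M * (h0 - s * hy - (2 * l' * θ' + l * θ'') * hsc)
  have hleq : l'' = l * θ' ^ 2 + grav * c - s / M * f₁ + (s ^ 2 / M + 1 / m) * f₂ t := by
    apply mul_left_cancel₀ hc.ne'
    have : c * (l * θ' ^ 2 + grav * c - s / M * f₁ + (s ^ 2 / M + 1 / m) * f₂ t) =
      c * l * θ' ^ 2 + grav * c ^ 2 - s * (c * f₁ - c * s * f₂ t) / M + c * f₂ t / m := by ring
    rw [this, hcf1, hcf]
    field_simp
    linear_combination M * (hy - grav * hsc)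
  rw [← hθeq, ← hxeq, ← hleq]

end Reference

/-! ### The desired state and the feedforward input as functions of the output derivatives -/

section Jet

variable (M m grav : ℝ)

/-- The arguments `(y₁'', y₁''', y₁'''', y₂', y₂'', y₂''', y₂'''', l_d)` on which the desired state
(up to the cart motion) and the feedforward input depend. -/
def outputJet (Y : ℝ → Output) (t : ℝ) : Fin 8 → ℝ :=
  ![yd Y 2 0 t, yd Y 3 0 t, yd Y 4 0 t, yd Y 1 1 t, yd Y 2 1 t, yd Y 3 1 t, yd Y 4 1 t, ld grav Y t]

/-- The swing angle as a function of the jet. -/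
def jetAngle (p : Fin 8 → ℝ) : ℝ := Real.arctan (-p 0 / (p 4 + grav))

/-- The specific payload force as a function of the jet. -/
def jetForce (p : Fin 8 → ℝ) : ℝ :=
  Real.sin (jetAngle grav p) * p 0 - Real.cos (jetAngle grav p) * (p 4 + grav)

/-- The time derivative of the specific payload force as a function of the jet. -/
def jetForceRate (p : Fin 8 → ℝ) : ℝ :=
  Real.sin (jetAngle grav p) * p 1 - Real.cos (jetAngle grav p) * p 5

/-- The angular velocity as a function of the jet. -/
def jetAngleRate (p : Fin 8 → ℝ) : ℝ :=
  (Real.cos (jetAngle grav p) * p 1 + Real.sin (jetAngle grav p) * p 5) / jetForce grav p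

/-- The velocity of the payload length as a function of the jet. -/
def jetLengthRate (p : Fin 8 → ℝ) : ℝ :=
  (p 7 * (Real.sin (jetAngle grav p) * jetAngleRate grav p) - p 3) / Real.cos (jetAngle grav p)

/-- The feedforward cart force as a function of the jet. -/
def jetCartForce (p : Fin 8 → ℝ) : ℝ :=
  M * p 7 / (m * jetForce grav p * Real.cos (jetAngle grav p)) *
    (-m * (Real.cos (jetAngle grav p) * p 2 + Real.sin (jetAngle grav p) * p 6)
      + 2 * (m * jetForceRate grav p) * jetAngleRate grav p
      + 1 / (M * p 7) * (m * jetForce grav p) ^ 2 * Real.sin (jetAngle grav p) *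
        Real.cos (jetAngle grav p)
      - 2 / p 7 * (m * jetForce grav p) * jetLengthRate grav p * jetAngleRate grav p
      - grav / p 7 * (m * jetForce grav p) * Real.sin (jetAngle grav p))

/-- The desired state with the cart motion removed, as a function of the jet. -/
def jetState (p : Fin 8 → ℝ) : State :=
  !₂[0, 0, jetAngle grav p, jetAngleRate grav p, p 7, jetLengthRate grav p]

/-- The feedforward input as a function of the jet. -/
def jetInput (p : Fin 8 → ℝ) : Fin 2 → ℝ := ![jetCartForce M m grav p, m * jetForce grav p]

variable {M m grav} {p : Fin 8 → ℝ}

lemma cos_jetAngle_ne_zero : Real.cos (jetAngle grav p) ≠ 0 := (Real.cos_arctan_pos _).ne'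

/-- Eliminating the sine exhibits the force as strictly negative, which legitimizes the divisions in
`jetAngleRate` and `jetCartForce`. -/
lemma jetForce_ne_zero (hp : 0 < p 4 + grav) : jetForce grav p ≠ 0 := by
  have hc : 0 < Real.cos (jetAngle grav p) := Real.cos_arctan_pos _
  have h := Real.tan_arctan (-p 0 / (p 4 + grav))
  rw [Real.tan_eq_sin_div_cos, div_eq_iff (Real.cos_arctan_pos _).ne'] at h
  change Real.sin (jetAngle grav p) = _ * Real.cos (jetAngle grav p) at h
  have : jetForce grav p =
      -(Real.cos (jetAngle grav p) * (p 0 ^ 2 / (p 4 + grav) + (p 4 + grav))) := by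
    rw [jetForce, h]; ring
  rw [this]
  exact (neg_neg_of_pos (by positivity)).ne

lemma continuousAt_jetAngle (hp : 0 < p 4 + grav) : ContinuousAt (jetAngle grav) p :=
  Real.continuous_arctan.continuousAt.comp (f := fun p : Fin 8 → ℝ ↦ -p 0 / (p 4 + grav))
    ((continuousAt_apply 0 p).neg.div ((continuousAt_apply 4 p).add continuousAt_const) hp.ne')

lemma continuousAt_sin_jetAngle (hp : 0 < p 4 + grav) :
    ContinuousAt (fun p ↦ Real.sin (jetAngle grav p)) p :=
  Real.continuous_sin.continuousAt.comp (continuousAt_jetAngle hp)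

lemma continuousAt_cos_jetAngle (hp : 0 < p 4 + grav) :
    ContinuousAt (fun p ↦ Real.cos (jetAngle grav p)) p :=
  Real.continuous_cos.continuousAt.comp (continuousAt_jetAngle hp)

lemma continuousAt_jetForce (hp : 0 < p 4 + grav) : ContinuousAt (jetForce grav) p :=
  ((continuousAt_sin_jetAngle hp).mul (continuousAt_apply 0 p)).sub
    ((continuousAt_cos_jetAngle hp).mul ((continuousAt_apply 4 p).add continuousAt_const))

lemma continuousAt_jetForceRate (hp : 0 < p 4 + grav) : ContinuousAt (jetForceRate grav) p :=
  ((continuousAt_sin_jetAngle hp).mul (continuousAt_apply 1 p)).sub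
    ((continuousAt_cos_jetAngle hp).mul (continuousAt_apply 5 p))

lemma continuousAt_jetAngleRate (hp : 0 < p 4 + grav) : ContinuousAt (jetAngleRate grav) p :=
  (((continuousAt_cos_jetAngle hp).mul (continuousAt_apply 1 p)).add
    ((continuousAt_sin_jetAngle hp).mul (continuousAt_apply 5 p))).div
    (continuousAt_jetForce hp) (jetForce_ne_zero hp)

lemma continuousAt_jetLengthRate (hp : 0 < p 4 + grav) : ContinuousAt (jetLengthRate grav) p :=
  (((continuousAt_apply 7 p).mul ((continuousAt_sin_jetAngle hp).mul
    (continuousAt_jetAngleRate hp))).sub (continuousAt_apply 3 p)).div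
    (continuousAt_cos_jetAngle hp) cos_jetAngle_ne_zero

lemma continuousAt_jetCartForce (hM : M ≠ 0) (hm : m ≠ 0) (hp : 0 < p 4 + grav) (hl : p 7 ≠ 0) :
    ContinuousAt (jetCartForce M m grav) p := by
  have hs := continuousAt_sin_jetAngle hp
  have hc := continuousAt_cos_jetAngle hp
  have hF := (continuousAt_const (y := m)).mul (continuousAt_jetForce hp)
  have hF' := (continuousAt_const (y := m)).mul (continuousAt_jetForceRate hp)
  have hθ := continuousAt_jetAngleRate hp
  have hl' := continuousAt_jetLengthRate hp
  have h7 := continuousAt_apply 7 p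
  have hMl := (continuousAt_const (y := M)).mul h7
  refine (hMl.div (hF.mul hc)
    (mul_ne_zero (mul_ne_zero hm (jetForce_ne_zero hp)) cos_jetAngle_ne_zero)).mul
    ((((ContinuousAt.add ?_ ?_).add ?_).sub ?_).sub ?_)
  · exact continuousAt_const.mul
      ((hc.mul (continuousAt_apply 2 p)).add (hs.mul (continuousAt_apply 6 p)))
  · exact (continuousAt_const.mul hF').mul hθ
  · exact (((continuousAt_const.div hMl (mul_ne_zero hM hl)).mul (hF.pow 2)).mul hs).mul hc
  · exact (((continuousAt_const.div h7 hl).mul hF).mul hl').mul hθ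
  · exact ((continuousAt_const.div h7 hl).mul hF).mul hs

lemma continuousAt_jetState (hp : 0 < p 4 + grav) : ContinuousAt (jetState grav) p := by
  have h : ContinuousAt (fun p ↦ (jetState grav p).ofLp) p := by
    rw [continuousAt_pi]
    intro i
    fin_cases i
    exacts [continuousAt_const, continuousAt_const, continuousAt_jetAngle hp,
      continuousAt_jetAngleRate hp, continuousAt_apply 7 p, continuousAt_jetLengthRate hp]
  exact (EuclideanSpace.equiv (Fin 6) ℝ).symm.continuous.continuousAt.comp h

lemma continuousAt_jetInput (hM : M ≠ 0) (hm : m ≠ 0) (hp : 0 < p 4 + grav) (hl : p 7 ≠ 0) :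
    ContinuousAt (jetInput M m grav) p := by
  rw [continuousAt_pi]
  intro i
  fin_cases i
  exacts [continuousAt_jetCartForce hM hm hp hl, continuousAt_const.mul (continuousAt_jetForce hp)]

/-- The jet of a constant output with payload length `l₀`. -/
def restJet (l₀ : ℝ) : Fin 8 → ℝ := ![0, 0, 0, 0, 0, 0, 0, l₀]

lemma jetState_restJet (l₀ : ℝ) : jetState grav (restJet l₀) = restState l₀ := by
  ext i
  fin_cases i <;> simp [jetState, restState, restJet, jetAngle, jetAngleRate, jetLengthRate]

lemma jetInput_restJet (l₀ : ℝ) : jetInput M m grav (restJet l₀) = restInput m grav := by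
  ext i
  fin_cases i <;>
    simp [jetInput, restInput, restJet, jetCartForce, jetAngle, jetAngleRate, jetForce]

variable {Y : ℝ → Output} {t : ℝ}

/-- The once-differentiated cable condition is linear in the angular velocity, with the nonzero
specific force as coefficient. -/
lemma deriv_thetad_eq_jetAngleRate (hY : ContDiff ℝ 4 Y) (ht : t ∈ regularTimes grav Y) :
    deriv (thetad grav Y) t = jetAngleRate grav (outputJet grav Y t) :=
  eq_div_of_mul_eq (jetForce_ne_zero (p := outputJet grav Y t) ht.1)
    (cos_mul_add_sin_mul_deriv hY ht).symm

lemma deriv_ld_eq_jetLengthRate (hY : ContDiff ℝ 4 Y) (ht : t ∈ regularTimes grav Y) :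
    deriv (ld grav Y) t = jetLengthRate grav (outputJet grav Y t) := by
  rw [jetLengthRate, ← deriv_thetad_eq_jetAngleRate hY ht, eq_div_iff cos_jetAngle_ne_zero]
  have h := yd_one_eq hY ht
  change deriv (ld grav Y) t * Real.cos (thetad grav Y t) = ld grav Y t *
    (Real.sin (thetad grav Y t) * deriv (thetad grav Y) t) - yd Y 1 1 t
  linear_combination h

lemma Xd_eq_jetState (hY : ContDiff ℝ 4 Y) (ht : t ∈ regularTimes grav Y) (i : Fin 6)
    (hi : 2 ≤ i) : Xd grav Y t i = jetState grav (outputJet grav Y t) i := by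
  fin_cases i
  · exact absurd hi (by decide)
  · exact absurd hi (by decide)
  · rfl
  · exact deriv_thetad_eq_jetAngleRate hY ht
  · rfl
  · exact deriv_ld_eq_jetLengthRate hY ht

lemma feedforward_eq_jetInput {f₂ f₂' : ℝ → ℝ} (h : IsFeedforwardF2 m grav Y f₂ f₂')
    (hY : ContDiff ℝ 4 Y) (hreg : ∀ t, 0 ≤ t → t ∈ regularTimes grav Y) (ht : 0 ≤ t) :
    feedforward M m grav Y f₂ f₂' t = jetInput M m grav (outputJet grav Y t) := by
  obtain ⟨h1, h2⟩ := h.eq hY hreg ht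
  have e1 : f₂ t = m * jetForce grav (outputJet grav Y t) := h1
  have e2 : f₂' t = m * jetForceRate grav (outputJet grav Y t) := h2
  have e3 := deriv_thetad_eq_jetAngleRate hY (hreg t ht)
  have e4 := deriv_ld_eq_jetLengthRate hY (hreg t ht)
  ext i
  fin_cases i
  · change feedforwardF1 M m grav Y f₂ f₂' t = jetCartForce M m grav (outputJet grav Y t)
    simp only [feedforwardF1, e1, e2, e3, e4]
    rfl
  · exact e1

lemma continuousAt_outputJet (hY : ContDiff ℝ 4 Y) (ht : t ∈ regularTimes grav Y) :
    ContinuousAt (outputJet grav Y) t := by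
  have h := fun i hi j ↦ (continuous_yd hY i hi j).continuousAt (x := t)
  rw [continuousAt_pi]
  intro i
  fin_cases i
  exacts [h 2 (by norm_num) 0, h 3 (by norm_num) 0, h 4 (by norm_num) 0, h 1 (by norm_num) 1,
    h 2 (by norm_num) 1, h 3 (by norm_num) 1, h 4 (by norm_num) 1,
    (contDiffAt_ld hY ht).continuousAt]

lemma dist_outputJet_restJet_lt {l₀ ρ : ℝ} (hρ : 0 < ρ)
    (hY : ∀ i ∈ Finset.Icc 1 4, ‖iteratedDeriv i Y t‖ < ρ) (hl : |ld grav Y t - l₀| < ρ) :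
    dist (outputJet grav Y t) (restJet l₀) < ρ := by
  have h : ∀ i ∈ Finset.Icc 1 4, ∀ j, dist (yd Y i j t) 0 < ρ := fun i hi j ↦ by
    rw [dist_zero_right]
    exact (PiLp.norm_apply_le (iteratedDeriv i Y t) j).trans_lt (hY i hi)
  rw [dist_pi_lt_iff hρ]
  intro i
  fin_cases i
  exacts [h 2 (by decide) 0, h 3 (by decide) 0, h 4 (by decide) 0, h 1 (by decide) 1,
    h 2 (by decide) 1, h 3 (by decide) 1, h 4 (by decide) 1, hl]

end Jet

end Crane

end

theorem mainTheorem4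
    (M m grav l₀ : ℝ) (hM : 0 < M) (hm : 0 < m) (hgrav : 0 < grav) (hl₀ : 0 < l₀)
    (k₁ k₂ k₃ k₄ k₅ k₆ : ℝ)
    (hK : Crane.StabilizingGains M m grav l₀ k₁ k₂ k₃ k₄ k₅ k₆) :
    ∃ ε > 0, ∃ δ > 0, ∀ Y : ℝ → Crane.Output,
      ContDiff ℝ 4 Y →
      (∀ t, 0 ≤ t → Y t 1 < 0) →
      (∀ i ∈ Finset.Icc 1 4, ∀ t, 0 ≤ t → ‖iteratedDeriv i Y t‖ ≤ ε) →
      (∀ t, 0 ≤ t → |Crane.ld grav Y t - l₀| ≤ δ) →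
      ∀ f₂ f₂' : ℝ → ℝ, Crane.IsFeedforwardF2 m grav Y f₂ f₂' →
        Crane.IsExponentiallyStableOrigin
          (Crane.errorField M m grav (Crane.gainMatrix k₁ k₂ k₃ k₄ k₅ k₆)
            (Crane.Xd grav Y) (Crane.feedforward M m grav Y f₂ f₂')) := by
  obtain ⟨U, hU, hstab⟩ :=
    Crane.exists_nhds_isExponentiallyStableOrigin_errorField M m grav hM hm hgrav hl₀ hK
  have hcont : ContinuousAt (fun p ↦ (Crane.jetState grav p, Crane.jetInput M m grav p))
      (Crane.restJet l₀) := by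
    have h4 : 0 < Crane.restJet l₀ 4 + grav := by simpa [Crane.restJet] using hgrav
    have h7 : Crane.restJet l₀ 7 ≠ 0 := by simpa [Crane.restJet] using hl₀.ne'
    exact (Crane.continuousAt_jetState h4).prodMk
      (Crane.continuousAt_jetInput hM.ne' hm.ne' h4 h7)
  rw [← Crane.jetState_restJet (grav := grav), ← Crane.jetInput_restJet (M := M) l₀] at hU
  obtain ⟨ρ, hρ, hball⟩ := Metric.mem_nhds_iff.1 (hcont hU)
  -- The bound `grav / 2` keeps `y₂'' + grav` positive, so all `t ≥ 0` are regular; `ρ / 2` turns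
  -- the weak bounds into strict ones that place the jet in the ball of radius `ρ`.
  refine ⟨min (ρ / 2) (grav / 2), by positivity, ρ / 2, by positivity,
    fun Y hY hneg hε hδ f₂ f₂' hf ↦ ?_⟩
  have hreg : ∀ t, 0 ≤ t → t ∈ Crane.regularTimes grav Y := fun t ht ↦ by
    refine ⟨?_, hneg t ht⟩
    have h1 : |Crane.yd Y 2 1 t| ≤ grav / 2 :=
      (PiLp.norm_apply_le (iteratedDeriv 2 Y t) 1).trans
        ((hε 2 (by decide) t ht).trans (min_le_right _ _))
    linarith [(abs_le.1 h1).1]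
  have hjet : ∀ t, 0 ≤ t → ContinuousWithinAt (Crane.outputJet grav Y) (Set.Ici 0) t :=
    fun t ht ↦ (Crane.continuousAt_outputJet hY (hreg t ht)).continuousWithinAt
  refine hstab (Crane.Xd grav Y) (fun t ↦ Crane.jetState grav (Crane.outputJet grav Y t)) _
    (fun t ht i hi ↦ Crane.Xd_eq_jetState hY (hreg t ht) i hi) (fun t ht ↦ ?_)
    (ContinuousOn.congr (fun t ht ↦ ?_)
      fun t ht ↦ Crane.feedforward_eq_jetInput hf hY hreg ht)
    (fun t ht ↦ ?_) (fun t ht ↦ Crane.deriv_Xd_eq_field hM hm hf hY hreg ht)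
  · exact (Crane.continuousAt_jetState (hreg t ht).1).comp_continuousWithinAt (hjet t ht)
  · exact (Crane.continuousAt_jetInput hM.ne' hm.ne' (hreg t ht).1
      (Crane.ld_pos (hreg t ht)).ne').comp_continuousWithinAt (hjet t ht)
  · rw [Crane.feedforward_eq_jetInput hf hY hreg ht]
    refine hball (Crane.dist_outputJet_restJet_lt hρ (fun i hi ↦ ?_) ?_)
    · exact ((hε i hi t ht).trans (min_le_left _ _)).trans_lt (half_lt_self hρ)
    · exact (hδ t ht).trans_lt (half_lt_self hρ)
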